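/- Let $k$ be an algebraically closed field of characteristic $0$, let $V := k^6$ with canonical basis $e_0,\dots,e_5$, let $X_0,\dots,X_5$ be the dual basis of $V^\vee$, and let $\mathbb{P}^5 = \mathbb{P}(V) = \operatorname{Proj} k[X_0,\dots,X_5]$ be the projective space of lines in $V$. For $q \ge 0$ and $l \in \mathbb{Z}$ realize $\Omega^q_{\mathbb{P}^5}(q+l)$ as the image of the ($l$-twisted) Koszul differential $$\mathcal{O}(l-1)\otimes \textstyle\bigwedge^{q+1}V^\vee \longrightarrow \mathcal{O}(l)\otimes \bigwedge^{q}V^\vee,\qquad \alpha \longmapsto \Big(\eta \mapsto \sum_i X_i\,\alpha(e_i\wedge\eta)\Big),$$ where $\bigwedge^qV^\vee$ is viewed as the dual of $\bigwedge^qV$. For $\omega \in \bigwedge^2 V$, the contraction $\bigwedge^{q+2}V^\vee \to \bigwedge^qV^\vee$, $\alpha \mapsto \alpha(\omega\wedge *)$, induces morphisms $\Omega^{q+2}_{\mathbb{P}^5}(q+2+l) \to \Omega^q_{\mathbb{P}^5}(q+l)$ for all $l$, which are the twists by $l$ of the morphism $\Omega^{q+2}_{\mathbb{P}^5}(q+2)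 \to \Omega^q_{\mathbb{P}^5}(q)$. Fix $\omega \in \bigwedge^2V$, let $\phi \colon \Omega^3_{\mathbb{P}^5}(3) \to \Omega^1_{\mathbb{P}^5}(1)$ be the case $q=1$ and $\psi \colon \Omega^2_{\mathbb{P}^5}(2) \to \mathcal{O}_{\mathbb{P}^5}$ the case $q = 0$. 1. The following assertions are equivalent: (i) $\phi$ is an epimorphism; (ii) there is a $k$-basis $v_0,\dots,v_5$ of $V$ such that $\omega = v_0\wedge v_1 + v_2\wedge v_3 + v_4\wedge v_5$; (iii) $H^0(\phi(1)) \colon H^0(\Omega^3_{\mathbb{P}^5}(4)) \to H^0(\Omega^1_{\mathbb{P}^5}(2))$ is bijective. 2. (a) $\psi$ is an epimorphism if and only if there is a $k$-basis $v_0,\dots,v_5$ of $V$ such that either $\omega = v_0\wedge v_1 + v_2\wedge v_3$ or $\omega = v_0\wedge v_1 + v_2\wedge v_3 + v_4\wedge v_5$. (b) If $\psi$ is an epimorphism, then $\operatorname{Ker}\psi(1)$, where $\psi(1) \colon \Omega^2_{\mathbb{P}^5}(3) \to \mathcal{O}_{\mathbb{P}^5}(1)$, is globally generated if and only if there is a $k$-basis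 $v_0,\dots,v_5$ of $V$ such that $\omega = v_0\wedge v_1 + v_2\wedge v_3 + v_4\wedge v_5$. -/

import Mathlib

universe u

noncomputable section

namespace ProjContraction

open CategoryTheory CategoryTheory.Limits AlgebraicGeometry TopologicalSpace

attribute [local instance] MvPolynomial.gradedAlgebra

variable (k : Type u) [Field k] (n : ℕ)

/-- The graded pieces of the homogeneous coordinate ring `k[X₀, …, Xₙ]`. -/
abbrev grading : ℕ → Submodule k (MvPolynomial (Fin (n + 1)) k) :=
  MvPolynomial.homogeneousSubmodule (Fin (n + 1)) k

/-- The projective space `ℙⁿ` over `k`, as a scheme. -/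
abbrev PSpace : Scheme.{u} := Proj (grading k n)

/-- The vector space `V = kⁿ⁺¹`; `ℙⁿ` parametrizes its lines, and `X₀, …, Xₙ` is the basis
of its dual which is dual to the canonical basis. -/
abbrev V : Type u := Fin (n + 1) → k

variable {k n}

/-- The homogeneous prime ideal of a point of `ℙⁿ`. -/
def primeOf (x : PSpace k n) : Ideal (MvPolynomial (Fin (n + 1)) k) :=
  (ProjectiveSpectrum.asHomogeneousIdeal (𝒜 := grading k n) x).toIdeal

instance (x : PSpace k n) : (primeOf x).IsPrime :=
  ProjectiveSpectrum.isPrime (𝒜 := grading k n) x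

/-- The localization of the homogeneous coordinate ring at the homogeneous prime of a point. -/
abbrev Loc (x : PSpace k n) : Type u := Localization.AtPrime (primeOf x)

variable {W W' : Type u} [AddCommGroup W] [Module k W] [AddCommGroup W'] [Module k W']

/-- A function on `U` with values in the localizations is, locally on `U`, a fraction of
homogeneous polynomials with `deg (numerator) - deg (denominator) = l`. -/
def IsTwistedSection (l : ℤ) (U : (PSpace k n).Opens) (s : ∀ x : U, Loc x.1) : Prop :=
  ∀ x : U, ∃ (U' : (PSpace k n).Opens) (_ : x.1 ∈ U') (hU : U' ≤ U) (i j : ℕ)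
    (a b : MvPolynomial (Fin (n + 1)) k), a ∈ grading k n i ∧ b ∈ grading k n j ∧
      (i : ℤ) = j + l ∧
      ∀ y : U', ∃ hb : b ∈ (primeOf y.1).primeCompl,
        s ⟨y.1, hU y.2⟩ = Localization.mk a ⟨b, hb⟩

theorem IsTwistedSection.add {l : ℤ} {U : (PSpace k n).Opens} {s t : ∀ x : U, Loc x.1}
    (hs : IsTwistedSection l U s) (ht : IsTwistedSection l U t) :
    IsTwistedSection l U (fun x ↦ s x + t x) := by
  intro x
  obtain ⟨U₁, hx₁, hU₁, i₁, j₁, a₁, b₁, ha₁, hb₁, h₁, e₁⟩ := hs x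
  obtain ⟨U₂, hx₂, hU₂, i₂, j₂, a₂, b₂, ha₂, hb₂, h₂, e₂⟩ := ht x
  refine ⟨U₁ ⊓ U₂, ⟨hx₁, hx₂⟩, inf_le_left.trans hU₁, j₁ + i₂, j₁ + j₂, b₁ * a₂ + b₂ * a₁,
    b₁ * b₂, add_mem (MvPolynomial.IsHomogeneous.mul hb₁ ha₂) ?_,
    MvPolynomial.IsHomogeneous.mul hb₁ hb₂, by push_cast; omega, ?_⟩
  · have : j₁ + i₂ = j₂ + i₁ := by omega
    rw [this]
    exact MvPolynomial.IsHomogeneous.mul hb₂ ha₁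
  · rintro ⟨y, hy₁, hy₂⟩
    obtain ⟨p₁, q₁⟩ := e₁ ⟨y, hy₁⟩
    obtain ⟨p₂, q₂⟩ := e₂ ⟨y, hy₂⟩
    refine ⟨Submonoid.mul_mem _ p₁ p₂, ?_⟩
    dsimp only at q₁ q₂ ⊢
    rw [q₁, q₂, Localization.add_mk]
    rfl

theorem exists_X_notMem (x : PSpace k n) : ∃ i : Fin (n + 1), MvPolynomial.X i ∉ primeOf x := by
  by_contra! H
  refine ProjectiveSpectrum.not_irrelevant_le (𝒜 := grading k n) x ?_
  intro f hf
  have hf' : f ∈ HomogeneousIdeal.irrelevant (grading k n) := hf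
  rw [HomogeneousIdeal.mem_irrelevant_iff] at hf'
  have h0 : MvPolynomial.coeff 0 f = 0 := by
    have h := congrArg (MvPolynomial.coeff 0) hf'
    have h' : ((DirectSum.decompose (grading k n) f 0 : grading k n 0) :
        MvPolynomial (Fin (n + 1)) k) = MvPolynomial.homogeneousComponent 0 f :=
      MvPolynomial.decomposition.decompose'_apply f 0
    rw [GradedRing.proj_apply, h', MvPolynomial.homogeneousComponent_zero] at h
    simpa using h
  have hle : Ideal.span (Set.range (MvPolynomial.X : Fin (n + 1) → MvPolynomial (Fin (n + 1)) k))
      ≤ primeOf x := by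
    rw [Ideal.span_le]
    rintro _ ⟨i, rfl⟩
    exact H i
  apply hle
  rw [← Set.image_univ, MvPolynomial.mem_ideal_span_X_image]
  intro m hm
  by_contra! hc
  have : m = 0 := by
    ext i
    simpa using hc i (Set.mem_univ i)
  subst this
  exact (MvPolynomial.mem_support_iff.mp hm) h0

theorem IsTwistedSection.zero (l : ℤ) (U : (PSpace k n).Opens) :
    IsTwistedSection l U (fun _ ↦ 0) := by
  intro x
  obtain ⟨i, hi⟩ := exists_X_notMem x.1
  refine ⟨U ⊓ Proj.basicOpen (grading k n) (MvPolynomial.X i), ⟨x.2, hi⟩, inf_le_left, l.toNat,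
    (-l).toNat, 0, MvPolynomial.X i ^ (-l).toNat, zero_mem _,
    MvPolynomial.isHomogeneous_X_pow _ _, by omega, ?_⟩
  rintro ⟨y, -, hy⟩
  exact ⟨Submonoid.pow_mem _ hy _, (Localization.mk_zero _).symm⟩

theorem IsTwistedSection.sum {ι : Type*} [Fintype ι] {l : ℤ} {U : (PSpace k n).Opens}
    {s : ι → ∀ x : U, Loc x.1} (hs : ∀ i, IsTwistedSection l U (s i)) :
    IsTwistedSection l U (fun x ↦ ∑ i, s i x) := by
  classical
  suffices ∀ t : Finset ι, IsTwistedSection l U (fun x ↦ ∑ i ∈ t, s i x) from this _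
  intro t
  induction t using Finset.induction_on with
  | empty => simpa only [Finset.sum_empty] using IsTwistedSection.zero l U
  | insert a t ha ih => simpa only [Finset.sum_insert ha] using (hs a).add ih

theorem IsTwistedSection.neg {l : ℤ} {U : (PSpace k n).Opens} {s : ∀ x : U, Loc x.1}
    (hs : IsTwistedSection l U s) : IsTwistedSection l U (fun x ↦ -s x) := by
  intro x
  obtain ⟨U', hx, hU, i, j, a, b, ha, hb, h, e⟩ := hs x
  refine ⟨U', hx, hU, i, j, -a, b, neg_mem ha, hb, h, fun y ↦ ?_⟩
  obtain ⟨p, q⟩ := e y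
  refine ⟨p, ?_⟩
  dsimp only at q ⊢
  rw [q, Localization.neg_mk]

theorem IsTwistedSection.X_mul {l l' : ℤ} (h : l' = l + 1) (c : Fin (n + 1))
    {U : (PSpace k n).Opens} {s : ∀ x : U, Loc x.1} (hs : IsTwistedSection l U s) :
    IsTwistedSection l' U (fun x ↦ algebraMap (MvPolynomial (Fin (n + 1)) k) (Loc x.1)
      (MvPolynomial.X c) * s x) := by
  intro x
  obtain ⟨U', hx, hU, i, j, a, b, ha, hb, hij, e⟩ := hs x
  refine ⟨U', hx, hU, 1 + i, j, MvPolynomial.X c * a, b,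
    MvPolynomial.IsHomogeneous.mul (MvPolynomial.isHomogeneous_X _ _) ha, hb,
    by push_cast; omega, fun y ↦ ?_⟩
  obtain ⟨p, q⟩ := e y
  refine ⟨p, ?_⟩
  dsimp only at q ⊢
  rw [q, ← Localization.mk_one_eq_algebraMap, Localization.mk_mul, one_mul]

/-- The value at a point of a section of the structure sheaf of `ℙⁿ`. -/
def value {U : (PSpace k n).Opens} (r : Γ(PSpace k n, U)) (x : U) : Loc x.1 :=
  HomogeneousLocalization.val (r.1 x)

theorem IsTwistedSection.smul {l : ℤ} {U : (PSpace k n).Opens} {s : ∀ x : U, Loc x.1}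
    (r : Γ(PSpace k n, U)) (hs : IsTwistedSection l U s) :
    IsTwistedSection l U (fun x ↦ value r x * s x) := by
  intro x
  obtain ⟨U₁, hx₁, hU₁, d, ⟨a₁, ha₁⟩, ⟨b₁, hb₁⟩, p₁, e₁⟩ := r.2 x
  obtain ⟨U₂, hx₂, hU₂, i, j, a₂, b₂, ha₂, hb₂, h₂, e₂⟩ := hs x
  let U₁' : (PSpace k n).Opens := U₁
  refine ⟨U₁' ⊓ U₂, ⟨hx₁, hx₂⟩, inf_le_right.trans hU₂, d + i, d + j, a₁ * a₂, b₁ * b₂,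
    MvPolynomial.IsHomogeneous.mul ha₁ ha₂, MvPolynomial.IsHomogeneous.mul hb₁ hb₂,
    by push_cast; omega, ?_⟩
  rintro ⟨y, hy₁, hy₂⟩
  obtain ⟨p₂, q₂⟩ := e₂ ⟨y, hy₂⟩
  have q₁ : value r ⟨y, hU₂ hy₂⟩ = Localization.mk a₁ ⟨b₁, p₁ ⟨y, hy₁⟩⟩ :=
    (congrArg HomogeneousLocalization.val (e₁ ⟨y, hy₁⟩)).trans
      (HomogeneousLocalization.val_mk _)
  refine ⟨Submonoid.mul_mem _ (p₁ ⟨y, hy₁⟩) p₂, ?_⟩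
  dsimp only at q₁ q₂ ⊢
  rw [q₁, q₂, Localization.mk_mul]
  rfl

theorem IsTwistedSection.res {l : ℤ} {U U' : (PSpace k n).Opens} (h : U' ≤ U)
    {s : ∀ x : U, Loc x.1} (hs : IsTwistedSection l U s) :
    IsTwistedSection l U' (fun x ↦ s ⟨x.1, h x.2⟩) := by
  intro x
  obtain ⟨U₁, hx, hU, i, j, a, b, ha, hb, hij, e⟩ := hs ⟨x.1, h x.2⟩
  exact ⟨U₁ ⊓ U', ⟨hx, x.2⟩, inf_le_right, i, j, a, b, ha, hb, hij, fun y ↦ e ⟨y.1, y.2.1⟩⟩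

theorem IsTwistedSection.of_local {l : ℤ} {U : (PSpace k n).Opens} {s : ∀ x : U, Loc x.1}
    (h : ∀ x : U, ∃ (U' : (PSpace k n).Opens) (_ : x.1 ∈ U') (hU : U' ≤ U),
      IsTwistedSection l U' (fun y ↦ s ⟨y.1, hU y.2⟩)) : IsTwistedSection l U s := by
  intro x
  obtain ⟨U', hx, hU, hs⟩ := h x
  obtain ⟨U₁, hx₁, hU₁, i, j, a, b, ha, hb, hij, e⟩ := hs ⟨x.1, hx⟩
  exact ⟨U₁, hx₁, hU₁.trans hU, i, j, a, b, ha, hb, hij, e⟩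

/-- The sections over `U` of the sheaf `Hom_k(W, 𝒪(l))` on `ℙⁿ`: families of
`k`-linear maps from `W` to the localizations whose values at each `w : W` form a section
of `𝒪(l)`. -/
def homSections (W : Type u) [AddCommGroup W] [Module k W] (l : ℤ) (U : (PSpace k n).Opens) :
    AddSubgroup (∀ x : U, W →ₗ[k] Loc x.1) where
  carrier := {s | ∀ w : W, IsTwistedSection l U (fun x ↦ s x w)}
  add_mem' hs ht w := (hs w).add (ht w)
  zero_mem' _ := IsTwistedSection.zero l U
  neg_mem' hs w := (hs w).neg

instance (l : ℤ) (U : (PSpace k n).Opens) : SMul Γ(PSpace k n, U) (homSections W l U) where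
  smul r s := ⟨fun x ↦ value r x • s.1 x, fun w ↦ (s.2 w).smul r⟩

theorem smul_val {l : ℤ} {U : (PSpace k n).Opens} (r : Γ(PSpace k n, U))
    (s : homSections W l U) (x : U) : (r • s).1 x = value r x • s.1 x := rfl

instance (l : ℤ) (U : (PSpace k n).Opens) : Module Γ(PSpace k n, U) (homSections W l U) where
  one_smul s := Subtype.ext <| funext fun x ↦ by
    rw [smul_val, show value (1 : Γ(PSpace k n, U)) x = 1 from HomogeneousLocalization.val_one,
      one_smul]
  mul_smul r r' s := Subtype.ext <| funext fun x ↦ by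
    rw [smul_val, smul_val, smul_val,
      show value (r * r') x = value r x * value r' x from HomogeneousLocalization.val_mul _ _,
      mul_smul]
  smul_zero r := Subtype.ext <| funext fun x ↦ smul_zero (value r x)
  smul_add r s t := Subtype.ext <| funext fun x ↦ smul_add (value r x) (s.1 x) (t.1 x)
  add_smul r r' s := Subtype.ext <| funext fun x ↦ by
    change value (r + r') x • s.1 x = value r x • s.1 x + value r' x • s.1 x
    rw [show value (r + r') x = value r x + value r' x from HomogeneousLocalization.val_add _ _,
      add_smul]
  zero_smul s := Subtype.ext <| funext fun x ↦ by
    rw [smul_val, show value (0 : Γ(PSpace k n, U)) x = 0 from HomogeneousLocalization.val_zero,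
      zero_smul]
    rfl

/-- The restriction of sections of `Hom_k(W, 𝒪(l))` to a smaller open set. -/
def homRes (W : Type u) [AddCommGroup W] [Module k W] (l : ℤ) {U U' : (PSpace k n).Opens}
    (h : U' ≤ U) : homSections W l U →+ homSections W l U' where
  toFun s := ⟨fun x ↦ s.1 ⟨x.1, h x.2⟩, fun w ↦ (s.2 w).res h⟩
  map_zero' := rfl
  map_add' _ _ := rfl

/-- The presheaf of abelian groups underlying `Hom_k(W, 𝒪(l))`. -/
def homPresheaf (k : Type u) [Field k] (n : ℕ) (W : Type u) [AddCommGroup W] [Module k W]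
    (l : ℤ) : TopCat.Presheaf Ab.{u} (PSpace k n) where
  obj U := AddCommGrpCat.of (homSections (k := k) (n := n) W l U.unop)
  map i := AddCommGrpCat.ofHom (homRes W l i.unop.le)

/-- The local predicate cutting out the sections of `Hom_k(W, 𝒪(l))`. -/
def homPredicate (k : Type u) [Field k] (n : ℕ) (W : Type u) [AddCommGroup W] [Module k W]
    (l : ℤ) : TopCat.LocalPredicate (X := (PSpace k n).carrier)
      (fun x : PSpace k n ↦ W →ₗ[k] Loc x) where
  pred {U} s := ∀ w : W, IsTwistedSection l U (fun x ↦ s x w)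
  res i _ hs w := (hs w).res i.le
  locality {_} _ hs w := IsTwistedSection.of_local fun x ↦ by
    obtain ⟨U', hx, i, h⟩ := hs x
    exact ⟨U', hx, i.le, h w⟩

/-- The sheaf of modules `Hom_k(W, 𝒪(l))` on `ℙⁿ`; it is `𝒪(l) ⊗ W^∨` when `W` is
finite-dimensional. -/
def twistHom (k : Type u) [Field k] (n : ℕ) (W : Type u) [AddCommGroup W] [Module k W]
    (l : ℤ) : (PSpace k n).Modules where
  val :=
    letI (U : (PSpace k n).Opensᵒᵖ) : Module ((PSpace k n).ringCatSheaf.obj.obj U)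
        ((homPresheaf k n W l).obj U) :=
      inferInstanceAs (Module Γ(PSpace k n, U.unop) (homSections W l U.unop))
    .ofPresheaf (homPresheaf k n W l) fun _ _ _ _ _ ↦ rfl
  isSheaf := (TopCat.Presheaf.isSheaf_iff_isSheaf_comp (forget AddCommGrpCat) _).2
    (TopCat.subsheafToTypes (homPredicate k n W l)).2

/-- The morphism `Hom_k(W, 𝒪(l)) ⟶ Hom_k(W', 𝒪(l'))` given by a family of linear maps between
the fibres which maps sections to sections. -/
def homOfFibres {l l' : ℤ} (f : ∀ x : PSpace k n, (W →ₗ[k] Loc x) →ₗ[Loc x] (W' →ₗ[k] Loc x))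
    (hf : ∀ (U : (PSpace k n).Opens), ∀ s ∈ homSections W l U,
      (fun x : U ↦ f x.1 (s x)) ∈ homSections W' l' U) :
    twistHom k n W l ⟶ twistHom k n W' l' :=
  SheafOfModules.Hom.mk <| PresheafOfModules.homMk
    (M₁ := (twistHom k n W l).val) (M₂ := (twistHom k n W' l').val)
    { app U := AddCommGrpCat.ofHom
        (X := homSections (k := k) (n := n) W l U.unop)
        (Y := homSections (k := k) (n := n) W' l' U.unop)
        { toFun s := ⟨fun x ↦ f x.1 (s.1 x), hf U.unop s.1 s.2⟩
          map_zero' := Subtype.ext <| funext fun x ↦ map_zero (f x.1)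
          map_add' s t := Subtype.ext <| funext fun x ↦ map_add (f x.1) (s.1 x) (t.1 x) }
      naturality _ _ _ := rfl }
    (fun U r s ↦ Subtype.ext <| funext fun x ↦
      map_smul (f x.1) (value (k := k) (n := n) (U := U.unop) r x) (s.1 x))

theorem homOfFibres_app {l l' : ℤ}
    (f : ∀ x : PSpace k n, (W →ₗ[k] Loc x) →ₗ[Loc x] (W' →ₗ[k] Loc x))
    (hf : ∀ (U : (PSpace k n).Opens), ∀ s ∈ homSections W l U,
      (fun x : U ↦ f x.1 (s x)) ∈ homSections W' l' U) (U : (PSpace k n).Opens)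
    (s : homSections W l U) :
    (homOfFibres f hf).app U s = (⟨fun x ↦ f x.1 (s.1 x), hf U s.1 s.2⟩ : homSections W' l' U) :=
  rfl

/-- Composition with a `k`-linear map `g : W' → W`, on the fibre at a point. -/
def precompFibre (g : W' →ₗ[k] W) (x : PSpace k n) : (W →ₗ[k] Loc x) →ₗ[Loc x] (W' →ₗ[k] Loc x) where
  toFun α := α ∘ₗ g
  map_add' _ _ := rfl
  map_smul' _ _ := rfl

theorem precompFibre_apply (g : W' →ₗ[k] W) (x : PSpace k n) (α : W →ₗ[k] Loc x) (w : W') :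
    precompFibre g x α w = α (g w) := rfl

/-- The morphism `Hom_k(W, 𝒪(l)) ⟶ Hom_k(W', 𝒪(l))` given by composition with a `k`-linear map
`g : W' → W`; in other words, `𝒪(l) ⊗ g^∨`. -/
def precomp (g : W' →ₗ[k] W) (l : ℤ) : twistHom k n W l ⟶ twistHom k n W' l :=
  homOfFibres (precompFibre g) (fun _ _ hs w ↦ hs (g w))

/-- The morphism `Hom_k(W, 𝒪(l-1)) ⟶ Hom_k(W', 𝒪(l))` given by `α ↦ ∑ i, X_i • (α ∘ g_i)`,
for `k`-linear maps `g_0, …, g_n : W' → W`. -/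
def sumXPrecomp (g : Fin (n + 1) → (W' →ₗ[k] W)) (l : ℤ) :
    twistHom k n W (l - 1) ⟶ twistHom k n W' l :=
  homOfFibres
    (fun x ↦ ∑ i : Fin (n + 1),
      algebraMap (MvPolynomial (Fin (n + 1)) k) (Loc x) (MvPolynomial.X i) • precompFibre (g i) x)
    (fun U s hs w ↦ by
      have key := IsTwistedSection.sum fun i : Fin (n + 1) ↦
        (hs (g i w)).X_mul (sub_add_cancel l 1).symm i
      simpa only [LinearMap.sum_apply, LinearMap.smul_apply, smul_eq_mul,
        precompFibre_apply] using key)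

/-- Left exterior multiplication `ω ∧ * : ⋀^q V → ⋀^m V` by `ω ∈ ⋀^p V`, where `m = p + q`. -/
def wedge {p q m : ℕ} (h : p + q = m) (ω : ⋀[k]^p (V k n)) : ⋀[k]^q (V k n) →ₗ[k] ⋀[k]^m (V k n) :=
  (LinearMap.mulLeft k (ω : ExteriorAlgebra k (V k n))).restrict fun _ hη ↦
    h ▸ SetLike.mul_mem_graded ω.2 hη

/-- The canonical basis vector `e_i` of `V`, as an element of `⋀¹ V`. -/
def basisVec (k : Type u) [Field k] (n : ℕ) (i : Fin (n + 1)) : ⋀[k]^1 (V k n) :=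
  exteriorPower.ιMulti k 1 ![Pi.single i 1]

/-- The differential `𝒪(l-1) ⊗ ⋀^{q+1} V^∨ ⟶ 𝒪(l) ⊗ ⋀^q V^∨` of the (twisted) tautological
Koszul complex on `ℙⁿ`; here `𝒪(l) ⊗ ⋀^q V^∨ = Hom_k(⋀^q V, 𝒪(l))`. It maps `α` to
`η ↦ ∑ i, X_i • α (e_i ∧ η)`, so that it is contraction with `v` on the fibre at `[v]`. -/
def koszul (k : Type u) [Field k] (n : ℕ) (q : ℕ) (l : ℤ) :
    twistHom k n (⋀[k]^(q + 1) (V k n)) (l - 1) ⟶ twistHom k n (⋀[k]^q (V k n)) l :=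
  sumXPrecomp (fun i ↦ wedge (Nat.add_comm 1 q) (basisVec k n i)) l

/-- The sheaf `Ω^q(q + l)` of twisted differential forms on `ℙⁿ`, realized as the image of the
differential `𝒪(l-1) ⊗ ⋀^{q+1} V^∨ ⟶ 𝒪(l) ⊗ ⋀^q V^∨` of the Koszul complex. -/
def Omega (k : Type u) [Field k] (n : ℕ) (q : ℕ) (l : ℤ) : (PSpace k n).Modules :=
  image (koszul k n q l)

/-- The inclusion of `Ω^q(q + l)` into `𝒪(l) ⊗ ⋀^q V^∨`. -/
def Omega.incl (k : Type u) [Field k] (n : ℕ) (q : ℕ) (l : ℤ) :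
    Omega k n q l ⟶ twistHom k n (⋀[k]^q (V k n)) l :=
  image.ι (koszul k n q l)

theorem basisVec_mul {p : ℕ} (i : Fin (n + 1)) (ω : ⋀[k]^p (V k n)) :
    (basisVec k n i : ExteriorAlgebra k (V k n)) * ω =
      (-1 : k) ^ p • ((ω : ExteriorAlgebra k (V k n)) * basisVec k n i) := by
  obtain ⟨ω, hω⟩ := ω
  have hb : (basisVec k n i : ExteriorAlgebra k (V k n)) =
      ExteriorAlgebra.ι k (Pi.single i 1) := by
    simp [basisVec, ExteriorAlgebra.ιMulti_apply]
  rw [hb]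
  dsimp only
  induction hω using Submodule.pow_induction_on_left' with
  | algebraMap r => simp [Algebra.commutes]
  | add x y j _ _ hx hy => rw [mul_add, hx, hy, add_mul, smul_add]
  | mem_mul m hm j x _ hx =>
    obtain ⟨v, rfl⟩ := hm
    have := ExteriorAlgebra.ι_add_mul_swap (R := k) (Pi.single i (1 : k)) v
    rw [← mul_assoc, eq_neg_of_add_eq_zero_left this, neg_mul, mul_assoc, hx, mul_smul_comm,
      pow_succ, mul_smul, neg_one_smul, smul_neg, mul_assoc]

/-- Contraction with `ω ∈ ⋀^p V`, as a morphism `𝒪(l) ⊗ ⋀^{p+q} V^∨ ⟶ 𝒪(l) ⊗ ⋀^q V^∨`: it maps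
`α` to `η ↦ α (ω ∧ η)`. -/
def contract {p q m : ℕ} (h : p + q = m) (ω : ⋀[k]^p (V k n)) (l : ℤ) :
    twistHom k n (⋀[k]^m (V k n)) l ⟶ twistHom k n (⋀[k]^q (V k n)) l :=
  precomp (wedge h ω) l

theorem wedge_wedge_basisVec {p q m : ℕ} (h : p + q = m) (ω : ⋀[k]^p (V k n)) (i : Fin (n + 1))
    (η : ⋀[k]^q (V k n)) :
    wedge (q := q + 1) (m := m + 1) (by omega) ((-1 : k) ^ p • ω)
        (wedge (Nat.add_comm 1 q) (basisVec k n i) η) =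
      wedge (Nat.add_comm 1 m) (basisVec k n i) (wedge h ω η) := by
  apply Subtype.ext
  change (((-1 : k) ^ p • ω : ⋀[k]^p (V k n)) : ExteriorAlgebra k (V k n)) *
    ((basisVec k n i : ExteriorAlgebra k (V k n)) * η) =
      (basisVec k n i : ExteriorAlgebra k (V k n)) * ((ω : ExteriorAlgebra k (V k n)) * η)
  rw [← mul_assoc, ← mul_assoc, basisVec_mul, Submodule.coe_smul, smul_mul_assoc]

theorem koszul_comp_contract {p q m : ℕ} (h : p + q = m) (ω : ⋀[k]^p (V k n)) (l : ℤ) :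
    contract (q := q + 1) (m := m + 1) (by omega) ((-1 : k) ^ p • ω) (l - 1) ≫ koszul k n q l =
      koszul k n m l ≫ contract h ω l := by
  apply Scheme.Modules.hom_ext
  intro U
  ext s
  refine Subtype.ext <| funext fun x ↦ LinearMap.ext fun η ↦ ?_
  have aux : ∀ t : ⋀[k]^(m + 1) (V k n) →ₗ[k] Loc (k := k) (n := n) x.1,
      (∑ i : Fin (n + 1), algebraMap (MvPolynomial (Fin (n + 1)) k) (Loc x.1)
        (MvPolynomial.X i) • precompFibre (wedge (Nat.add_comm 1 q) (basisVec k n i)) x.1)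
        (precompFibre (wedge (q := q + 1) (by omega) ((-1 : k) ^ p • ω)) x.1 t) η =
      precompFibre (wedge h ω) x.1 ((∑ i : Fin (n + 1),
        algebraMap (MvPolynomial (Fin (n + 1)) k) (Loc x.1) (MvPolynomial.X i) •
          precompFibre (wedge (Nat.add_comm 1 m) (basisVec k n i)) x.1) t) η := by
    intro t
    simp only [LinearMap.sum_apply, LinearMap.smul_apply, precompFibre_apply,
      wedge_wedge_basisVec h]
  exact aux _

/-- The morphism `Ω^{p+q}(p+q+l) ⟶ Ω^q(q+l)` induced by contraction with `ω ∈ ⋀^p V`; it is the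
twist by `l` of the morphism `Ω^{p+q}(p+q) ⟶ Ω^q(q)`. -/
def contractOmega {p q m : ℕ} (h : p + q = m) (ω : ⋀[k]^p (V k n)) (l : ℤ) :
    Omega k n m l ⟶ Omega k n q l :=
  image.map (Arrow.homMk _ _ (koszul_comp_contract h ω l) :
    Arrow.mk (koszul k n m l) ⟶ Arrow.mk (koszul k n q l))

theorem contractOmega_incl {p q m : ℕ} (h : p + q = m) (ω : ⋀[k]^p (V k n)) (l : ℤ) :
    contractOmega h ω l ≫ Omega.incl k n q l = Omega.incl k n m l ≫ contract h ω l :=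
  image.map_ι _

/-- The invertible sheaf `𝒪(l) = Hom_k(k, 𝒪(l))` on `ℙⁿ`. -/
abbrev twistedSheaf (k : Type u) [Field k] (n : ℕ) (l : ℤ) : (PSpace k n).Modules :=
  twistHom k n k l

/-- The morphism `Ω^p(p+l) ⟶ 𝒪(l)` given by contraction with `ω ∈ ⋀^p V`, that is, by
`α ↦ α(ω)`; it is the twist by `l` of the morphism `Ω^p(p) ⟶ 𝒪`. -/
def contractStructure {p : ℕ} (ω : ⋀[k]^p (V k n)) (l : ℤ) :
    Omega k n p l ⟶ twistedSheaf k n l :=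
  Omega.incl k n p l ≫ precomp (LinearMap.toSpanSingleton k (⋀[k]^p (V k n)) ω) l

/-- A sheaf of modules on `ℙⁿ` is globally generated if it is generated by some family of global
sections. -/
def IsGloballyGenerated (M : (PSpace k n).Modules) : Prop :=
  Nonempty (SheafOfModules.GeneratingSections (R := (PSpace k n).ringCatSheaf) M)

/-- `ω = v₀ ∧ v₁ + v₂ ∧ v₃` for some basis `v₀, …, v₅` of `k⁶`. -/
def HasRankFour (ω : ⋀[k]^2 (V k 5)) : Prop :=
  ∃ v : Module.Basis (Fin 6) k (V k 5),
    ω = exteriorPower.ιMulti k 2 ![v 0, v 1] + exteriorPower.ιMulti k 2 ![v 2, v 3]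

/-- `ω = v₀ ∧ v₁ + v₂ ∧ v₃ + v₄ ∧ v₅` for some basis `v₀, …, v₅` of `k⁶`. -/
def HasRankSix (ω : ⋀[k]^2 (V k 5)) : Prop :=
  ∃ v : Module.Basis (Fin 6) k (V k 5),
    ω = exteriorPower.ιMulti k 2 ![v 0, v 1] + exteriorPower.ιMulti k 2 ![v 2, v 3] +
      exteriorPower.ιMulti k 2 ![v 4, v 5]

end ProjContraction

end

/-! Write `v ⌟ α` for the form `α(v ∧ *)`. On the fibre at `[v]`, `Ω^q(q)` consists of the `v ⌟ α`
with `α` in `⋀^{q+1} V^∨`. Since `ω` has even degree, `φ` sends `v ⌟ α` to `v ⌟ (α ∘ (ω ∧ *))`, and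
`ψ` sends it to `α(v ∧ ω)`. So everything is governed by the maps `ω ∧ *` on `V` and on `⋀² V`
(`contractX_comp_wedge`, `residue_contractX`).

For `φ`: if `ω ∧ *` is injective on `⋀² V`, a linear retraction lifts local sections; if it kills
some `v ∧ w ≠ 0`, surjectivity fails at `[v]`. On global sections, `H⁰(Ω^q(q+1)) = ⋀^{q+1} V^∨` for
`q > 0`, by exactness of the Koszul complex in polynomial degree one, and `φ(1)` becomes the
transpose of `ω ∧ * : ⋀² V → ⋀⁴ V`. For `ψ`: it is onto exactly when `ω ∧ v ≠ 0` for all `v ≠ 0`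
(`epi_contractStructure_iff`).

A bivector is a sum of at most three products of disjoint pairs from a basis (`exists_normal_form`).
In rank six `ω ∧ *` is bijective from `⋀² V` to `⋀⁴ V` by a hard Lefschetz argument (`lambda_mul`);
in lower rank `v₀ ∧ v₂` is killed; `ω ∧ *` is injective on `V` exactly in rank at least four.

The global sections of `Ker ψ(1)` are the forms on `⋀³ V` that vanish on `ω ∧ V`. In rank six a
local lift of a section can be corrected by a Koszul boundary until it vanishes on `ω ∧ V`, so they
generate. In rank four, `v₀ ∧ v₁ ∧ v₂ = ω ∧ v₂` forces all of them to vanish on `v₁ ∧ v₂` at `[v₀]`,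
although some local section does not. -/

noncomputable section

/-! ### Sheaves of modules: epimorphisms, kernels and global generation in terms of sections. -/

namespace AlgebraicGeometry.Scheme.Modules

open CategoryTheory CategoryTheory.Limits TopologicalSpace

variable {X : Scheme.{u}} {M N : X.Modules}

theorem naturality_apply (f : M ⟶ N) {U V : X.Opens} (i : V ⟶ U) (s : Γ(M, U)) :
    f.app V (M.presheaf.map i.op s) = N.presheaf.map i.op (f.app U s) :=
  PresheafOfModules.naturality_apply f.val i.op s

theorem eq_of_locally_eq (M : X.Modules) {U : X.Opens} {s t : Γ(M, U)}
    (h : ∀ x ∈ U, ∃ (V : X.Opens) (i : V ⟶ U), x ∈ V ∧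
      M.presheaf.map i.op s = M.presheaf.map i.op t) : s = t := by
  choose V i hV h using h
  refine TopCat.Sheaf.eq_of_locally_eq' (ι := U) ⟨M.presheaf, M.isSheaf⟩ (fun x ↦ V x.1 x.2) U
    (fun x ↦ i x.1 x.2) (fun x hx ↦ ?_) s t (fun x ↦ h x.1 x.2)
  exact Opens.mem_iSup.mpr ⟨⟨x, hx⟩, hV x hx⟩

/-- If every morphism from `N` vanishing on a subpresheaf `P` of modules is zero, then every section
of `N` belongs locally to `P`. -/
theorem exists_mem_of_forall_eq_zero (P : PresheafOfModules.Submodule N.val)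
    (h : ∀ (Z : X.Modules) (g : N ⟶ Z),
      (∀ (U : X.Opens) (t : Γ(N, U)), t ∈ P.obj (.op U) → g.app U t = 0) → g = 0)
    (U : X.Opens) (t : Γ(N, U)) (x : X) (hx : x ∈ U) :
    ∃ (V : X.Opens) (i : V ⟶ U), x ∈ V ∧ N.presheaf.map i.op t ∈ P.obj (.op V) := by
  -- The test morphism is `N → N/P → (N/P)^#`. It vanishes on `P`, hence is zero; as the unit of
  -- sheafification is locally injective, `t` already dies locally in the presheaf quotient `N/P`.
  let C := cokernel P.ι
  let a := PresheafOfModules.sheafificationAdjunction (𝟙 X.ringCatSheaf.obj)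
  let Z : X.Modules := (PresheafOfModules.sheafification (𝟙 X.ringCatSheaf.obj)).obj C
  let η : C ⟶ Z.val := a.unit.app C
  let g : N ⟶ Z := SheafOfModules.Hom.mk (cokernel.π P.ι ≫ η)
  have hg : g = 0 := by
    refine h Z g fun U t ht ↦ ?_
    have h0 := congr($(congr(($(cokernel.condition P.ι)).app (.op U))) ⟨t, ht⟩)
    change η.app (.op U) ((cokernel.π P.ι).app (.op U) t) = 0
    refine (congrArg (η.app (.op U)) h0).trans ?_
    exact map_zero (η.app (.op U)).hom
  have hinj : Presheaf.IsLocallyInjective (Opens.grothendieckTopology X)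
      (CategoryTheory.toSheafify (Opens.grothendieckTopology X) C.presheaf) := inferInstance
  have h1 : CategoryTheory.toSheafify (Opens.grothendieckTopology X) C.presheaf =
      (PresheafOfModules.toPresheaf _).map η := rfl
  have h2 : η.app (.op U) ((cokernel.π P.ι).app (.op U) t) = 0 :=
    congr($(congr(($hg).app U)) t)
  obtain ⟨V, i, hi, hxV⟩ := hinj.equalizerSieve_mem (X := .op U)
    ((cokernel.π P.ι).app (.op U) t) 0 (by
      rw [h1]
      exact h2.trans (map_zero (η.app (.op U)).hom).symm) x hx
  refine ⟨V, i, hxV, ?_⟩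
  have h3 : (cokernel.π P.ι).app (.op V) (N.val.map i.op t) = 0 := by
    refine (PresheafOfModules.naturality_apply (cokernel.π P.ι) i.op t).trans ?_
    exact hi.trans (map_zero (C.presheaf.map i.op).hom)
  -- Evaluation on `V` is exact on presheaves, so vanishing in `N/P` over `V` is membership in `P`.
  let F := PresheafOfModules.evaluation X.ringCatSheaf.obj (.op V)
  have hS := (ShortComplex.exact_cokernel P.ι).map F
  rw [ShortComplex.moduleCat_exact_iff] at hS
  obtain ⟨y, hy⟩ := hS (N.val.map i.op t) h3
  have hy' : N.val.map i.op t = y.1 := hy.symm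
  exact hy' ▸ y.2

theorem epi_of_locally_surjective (f : M ⟶ N)
    (h : ∀ (U : X.Opens) (t : Γ(N, U)), ∀ x ∈ U, ∃ (V : X.Opens) (i : V ⟶ U), x ∈ V ∧
      ∃ s : Γ(M, V), f.app V s = N.presheaf.map i.op t) : Epi f where
  left_cancellation {Z} g₁ g₂ hg := by
    refine hom_ext _ _ fun U ↦ ?_
    ext t
    refine eq_of_locally_eq Z fun x hx ↦ ?_
    obtain ⟨V, i, hV, s, hs⟩ := h U t x hx
    refine ⟨V, i, hV, ?_⟩
    rw [← naturality_apply, ← naturality_apply, ← hs]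
    exact congr($(congr(($hg).app V)) s)

/-- The presheaf image of a morphism of sheaves of modules. -/
def presheafRange (f : M ⟶ N) : PresheafOfModules.Submodule N.val where
  obj U := LinearMap.range (f.val.app U).hom
  map i := by
    rintro _ ⟨s, rfl⟩
    exact ⟨M.val.map i s, PresheafOfModules.naturality_apply f.val i s⟩

theorem locally_surjective_of_epi (f : M ⟶ N) [Epi f] (U : X.Opens) (t : Γ(N, U)) (x : X)
    (hx : x ∈ U) : ∃ (V : X.Opens) (i : V ⟶ U), x ∈ V ∧
      ∃ s : Γ(M, V), f.app V s = N.presheaf.map i.op t := by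
  refine exists_mem_of_forall_eq_zero (presheafRange f) (fun Z g hg ↦ ?_) U t x hx
  rw [← cancel_epi f, comp_zero]
  refine hom_ext _ _ fun V ↦ ?_
  ext s
  exact hg V _ ⟨s, rfl⟩

theorem app_injective_of_mono (f : M ⟶ N) [Mono f] (U : X.Opens) :
    Function.Injective (f.app U) := by
  have : Mono ((toPresheaf X).map f) := inferInstance
  have : Mono (((toPresheaf X).map f).app (.op U)) := inferInstance
  exact (AddCommGrpCat.mono_iff_injective _).mp this

theorem app_kernel_ι (f : M ⟶ N) (U : X.Opens) (s : Γ(kernel f, U)) :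
    f.app U ((kernel.ι f).app U s) = 0 :=
  congr($(congr(($(kernel.condition f)).app U)) s)

/-- Taking sections over `U` is left exact. -/
theorem exists_app_kernel_ι_eq (f : M ⟶ N) (U : X.Opens) (s : Γ(M, U)) (hs : f.app U s = 0) :
    ∃ t : Γ(kernel f, U), (kernel.ι f).app U t = s := by
  let F : X.Modules ⥤ Ab.{u} :=
    toPresheaf X ⋙ (CategoryTheory.evaluation X.Opensᵒᵖ Ab.{u}).obj (.op U)
  have : PreservesLimitsOfShape WalkingParallelPair
      ((CategoryTheory.evaluation X.Opensᵒᵖ Ab.{u}).obj (.op U)) :=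
    evaluation_preservesLimitsOfShape _
  have : F.PreservesZeroMorphisms := ⟨fun _ _ ↦ rfl⟩
  have : PreservesLimitsOfShape WalkingParallelPair F := comp_preservesLimitsOfShape _ _
  let S := ShortComplex.mk _ _ (kernel.condition f)
  have hS : S.Exact := ShortComplex.exact_kernel f
  have : Mono S.f := inferInstanceAs (Mono (kernel.ι f))
  have := hS.map_of_mono_of_preservesKernel F inferInstance inferInstance
  rw [ShortComplex.ab_exact_iff] at this
  exact this s hs


/-- The global section given by a compatible family of sections. -/
def ofSections (s : SheafOfModules.sections (R := X.ringCatSheaf) M) : Γ(M, ⊤) := s.1 (.op ⊤)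

theorem map_ofSections (s : SheafOfModules.sections (R := X.ringCatSheaf) M) (U : X.Opens) :
    M.presheaf.map (homOfLE le_top).op (ofSections s) = s.1 (.op U) :=
  s.2 (homOfLE (le_top : U ≤ ⊤)).op

/-- The compatible family of restrictions of a global section. -/
def toSections (s : Γ(M, ⊤)) : SheafOfModules.sections (R := X.ringCatSheaf) M :=
  PresheafOfModules.sectionsMk (fun U ↦ M.presheaf.map (homOfLE (le_top : U.unop ≤ ⊤)).op s)
    fun U _ i ↦ (congr($(M.presheaf.map_comp (homOfLE (le_top : U.unop ≤ ⊤)).op i) s)).symm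

/-- The submodules of the sections of `M` spanned by restrictions of global sections. -/
def globalSpan (M : X.Modules) (U : X.Opens) : Submodule Γ(X, U) Γ(M, U) :=
  Submodule.span _ {r | ∃ s : Γ(M, ⊤), M.presheaf.map (homOfLE le_top).op s = r}

theorem map_mem_globalSpan {U V : X.Opens} (i : V ⟶ U) {t : Γ(M, U)} (ht : t ∈ globalSpan M U) :
    M.presheaf.map i.op t ∈ globalSpan M V := by
  induction ht using Submodule.span_induction with
  | mem t ht =>
    obtain ⟨s, rfl⟩ := ht
    exact Submodule.subset_span ⟨s, congr($(M.presheaf.map_comp (homOfLE le_top).op i.op) s)⟩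
  | zero => rw [map_zero]; exact zero_mem _
  | add s t _ _ hs ht => rw [map_add]; exact add_mem hs ht
  | smul r t _ ht => rw [map_smul]; exact Submodule.smul_mem _ _ ht

/-- The subpresheaf of modules generated by the global sections. -/
def globalSubmodule (M : X.Modules) : PresheafOfModules.Submodule M.val where
  obj U := globalSpan M U.unop
  map i _ ht := map_mem_globalSpan i.unop ht

/-- A morphism that kills all global sections agrees with `0` after composition with the epimorphism
from the free module, so `exists_mem_of_forall_eq_zero` applies. -/
theorem mem_globalSpan_of_generatingSections
    (σ : SheafOfModules.GeneratingSections (R := X.ringCatSheaf) M)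
    (U : X.Opens) (t : Γ(M, U)) (x : X) (hx : x ∈ U) :
    ∃ (V : X.Opens) (i : V ⟶ U), x ∈ V ∧ M.presheaf.map i.op t ∈ globalSpan M V := by
  refine exists_mem_of_forall_eq_zero (globalSubmodule M) (fun Z g hg ↦ ?_) U t x hx
  let z : M ⟶ Z := 0
  have := σ.epi
  have key : (fun i ↦ SheafOfModules.sectionsMap (R := X.ringCatSheaf) g (σ.s i)) =
      fun i ↦ SheafOfModules.sectionsMap (R := X.ringCatSheaf) z (σ.s i) := by
    ext i : 1
    refine PresheafOfModules.sections_ext _ _ fun U ↦ ?_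
    have h1 : (σ.s i).1 (.op U.unop) ∈ globalSpan M U.unop :=
      Submodule.subset_span ⟨_, map_ofSections (σ.s i) U.unop⟩
    exact hg U.unop _ h1
  have h1 := SheafOfModules.freeHomEquiv_symm_comp (R := X.ringCatSheaf) σ.s g
  have h2 := SheafOfModules.freeHomEquiv_symm_comp (R := X.ringCatSheaf) σ.s z
  exact this.left_cancellation g z (h1.trans ((congrArg _ key).trans h2.symm))

theorem hom_ext_of_mem_globalSpan {Z : X.Modules} {g₁ g₂ : M ⟶ Z}
    (h : ∀ (U : X.Opens) (t : Γ(M, U)), ∀ x ∈ U, ∃ (V : X.Opens) (i : V ⟶ U), x ∈ V ∧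
      M.presheaf.map i.op t ∈ globalSpan M V)
    (hg : ∀ (s : Γ(M, ⊤)) (V : X.Opens), g₁.app V (M.presheaf.map (homOfLE le_top).op s) =
      g₂.app V (M.presheaf.map (homOfLE le_top).op s)) : g₁ = g₂ := by
  refine hom_ext _ _ fun U ↦ ?_
  ext t
  refine eq_of_locally_eq Z fun x hx ↦ ?_
  obtain ⟨V, i, hV, ht⟩ := h U t x hx
  refine ⟨V, i, hV, ?_⟩
  rw [← naturality_apply, ← naturality_apply]
  generalize M.presheaf.map i.op t = t' at ht
  induction ht using Submodule.span_induction with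
  | mem t ht =>
    obtain ⟨s, rfl⟩ := ht
    exact hg s V
  | zero => rw [map_zero, map_zero]
  | add s t _ _ hs ht => rw [map_add, map_add, hs, ht]
  | smul r t _ ht => rw [Hom.app_smul, Hom.app_smul, ht]

/-- The family of all global sections serves as the generating family. -/
theorem generatingSections_of_mem_globalSpan
    (h : ∀ (U : X.Opens) (t : Γ(M, U)), ∀ x ∈ U, ∃ (V : X.Opens) (i : V ⟶ U), x ∈ V ∧
      M.presheaf.map i.op t ∈ globalSpan M V) :
    Nonempty (SheafOfModules.GeneratingSections (R := X.ringCatSheaf) M) := by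
  refine ⟨⟨Γ(M, ⊤), toSections, ⟨fun {Z} g₁ g₂ hg ↦ ?_⟩⟩⟩
  have hg := (SheafOfModules.freeHomEquiv_symm_comp (R := X.ringCatSheaf) toSections g₁).symm.trans
    (hg.trans (SheafOfModules.freeHomEquiv_symm_comp (R := X.ringCatSheaf) toSections g₂))
  exact hom_ext_of_mem_globalSpan (Z := Z) h fun s V ↦
    congr(($(congrFun ((SheafOfModules.freeHomEquiv Z).symm.injective hg) s)).1 (.op V))

end AlgebraicGeometry.Scheme.Modules

end

noncomputable section

namespace ProjContraction

open CategoryTheory CategoryTheory.Limits AlgebraicGeometry TopologicalSpace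

attribute [local instance] MvPolynomial.gradedAlgebra

variable {k : Type u} [Field k] {n : ℕ}

/-- The `i`-th homogeneous coordinate, in the localization at a point. -/
abbrev coord (x : PSpace k n) (i : Fin (n + 1)) : Loc x :=
  algebraMap (MvPolynomial (Fin (n + 1)) k) (Loc x) (MvPolynomial.X i)

/-! ### Sections of `𝒪(l)` and inverses of coordinates. -/

section TwistedSections

theorem IsTwistedSection.of_frac {l : ℤ} {U : (PSpace k n).Opens} {s : ∀ x : U, Loc x.1} {i j : ℕ}
    {a b : MvPolynomial (Fin (n + 1)) k} (ha : a ∈ grading k n i) (hb : b ∈ grading k n j)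
    (h : (i : ℤ) = j + l)
    (hs : ∀ y : U, ∃ hb : b ∈ (primeOf y.1).primeCompl, s y = Localization.mk a ⟨b, hb⟩) :
    IsTwistedSection l U s :=
  fun x ↦ ⟨U, x.2, le_rfl, i, j, a, b, ha, hb, h, fun y ↦ hs ⟨y.1, y.2⟩⟩

theorem IsTwistedSection.polynomial {d : ℕ} (U : (PSpace k n).Opens)
    {p : MvPolynomial (Fin (n + 1)) k} (hp : p ∈ grading k n d) :
    IsTwistedSection d U (fun x ↦ algebraMap (MvPolynomial (Fin (n + 1)) k) (Loc x.1) p) :=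
  .of_frac (j := 0) (b := 1) hp (MvPolynomial.isHomogeneous_one _ _) (by simp) fun _ ↦
    ⟨Submonoid.one_mem _, (Localization.mk_one_eq_algebraMap p).symm⟩

theorem IsTwistedSection.mul {l l' l'' : ℤ} (h : l + l' = l'') {U : (PSpace k n).Opens}
    {s t : ∀ x : U, Loc x.1} (hs : IsTwistedSection l U s) (ht : IsTwistedSection l' U t) :
    IsTwistedSection l'' U (fun x ↦ s x * t x) := by
  intro x
  obtain ⟨U₁, hx₁, hU₁, i₁, j₁, a₁, b₁, ha₁, hb₁, h₁, e₁⟩ := hs x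
  obtain ⟨U₂, hx₂, hU₂, i₂, j₂, a₂, b₂, ha₂, hb₂, h₂, e₂⟩ := ht x
  refine ⟨U₁ ⊓ U₂, ⟨hx₁, hx₂⟩, inf_le_left.trans hU₁, i₁ + i₂, j₁ + j₂, a₁ * a₂, b₁ * b₂,
    MvPolynomial.IsHomogeneous.mul ha₁ ha₂, MvPolynomial.IsHomogeneous.mul hb₁ hb₂,
    by push_cast; omega, ?_⟩
  rintro ⟨y, hy₁, hy₂⟩
  obtain ⟨p₁, q₁⟩ := e₁ ⟨y, hy₁⟩
  obtain ⟨p₂, q₂⟩ := e₂ ⟨y, hy₂⟩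
  refine ⟨Submonoid.mul_mem _ p₁ p₂, ?_⟩
  dsimp only at q₁ q₂ ⊢
  rw [q₁, q₂, Localization.mk_mul]
  rfl

theorem IsTwistedSection.sub {l : ℤ} {U : (PSpace k n).Opens} {s t : ∀ x : U, Loc x.1}
    (hs : IsTwistedSection l U s) (ht : IsTwistedSection l U t) :
    IsTwistedSection l U (fun x ↦ s x - t x) := by
  simpa only [sub_eq_add_neg] using hs.add ht.neg

/-- The inverse of `X_j` in the localization at a point where `X_j` does not vanish. -/
def invX (j : Fin (n + 1)) (x : PSpace k n) : Loc x :=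
  Ring.inverse (coord x j)

theorem X_mul_invX {j : Fin (n + 1)} {x : PSpace k n} (hx : MvPolynomial.X j ∉ primeOf x) :
    coord x j * invX j x = 1 :=
  Ring.mul_inverse_cancel _ (IsLocalization.map_units (M := (primeOf x).primeCompl) _ ⟨_, hx⟩)

theorem invX_eq_mk {j : Fin (n + 1)} {x : PSpace k n}
    (hx : MvPolynomial.X j ∈ (primeOf x).primeCompl) :
    invX j x = Localization.mk 1 ⟨MvPolynomial.X j, hx⟩ := by
  have hu : IsUnit (coord x j) := IsLocalization.map_units (M := (primeOf x).primeCompl) _ ⟨_, hx⟩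
  refine hu.mul_left_cancel ((X_mul_invX hx).trans ?_)
  rw [coord, ← Localization.mk_one_eq_algebraMap, Localization.mk_mul, one_mul, mul_one]
  exact (Localization.mk_self (⟨MvPolynomial.X j, hx⟩ : (primeOf x).primeCompl)).symm

theorem IsTwistedSection.invX {j : Fin (n + 1)} {U : (PSpace k n).Opens}
    (hU : U ≤ Proj.basicOpen (grading k n) (MvPolynomial.X j)) :
    IsTwistedSection (-1) U (fun x ↦ ProjContraction.invX j x.1) :=
  .of_frac (i := 0) (MvPolynomial.isHomogeneous_one _ _) (MvPolynomial.isHomogeneous_X k j)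
    (by simp)
    fun y ↦ ⟨hU y.2, invX_eq_mk (hU y.2)⟩

/-- Sections of `𝒪(0)` come from sections of the structure sheaf. -/
theorem IsTwistedSection.exists_value_eq {U : (PSpace k n).Opens} {s : ∀ x : U, Loc x.1}
    (hs : IsTwistedSection 0 U s) : ∃ r : Γ(PSpace k n, U), ∀ x, value r x = s x := by
  have key : ∀ x : U, ∃ z : HomogeneousLocalization.AtPrime (grading k n) (primeOf x.1),
      z.val = s x := by
    intro x
    obtain ⟨U', hx, hU, i, j, a, b, ha, hb, hij, e⟩ := hs x
    obtain ⟨hb', e⟩ := e ⟨x.1, hx⟩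
    have : i = j := by omega
    subst this
    exact ⟨HomogeneousLocalization.mk ⟨i, ⟨a, ha⟩, ⟨b, hb⟩, hb'⟩,
      (HomogeneousLocalization.val_mk _).trans e.symm⟩
  choose z hz using key
  refine ⟨⟨z, fun x ↦ ?_⟩, hz⟩
  obtain ⟨U', hx, hU, i, j, a, b, ha, hb, hij, e⟩ := hs x
  have : i = j := by omega
  subst this
  refine ⟨U', hx, homOfLE hU, i, ⟨a, ha⟩, ⟨b, hb⟩, fun y ↦ (e y).1, fun y ↦ ?_⟩
  apply HomogeneousLocalization.val_injective
  obtain ⟨hb', e'⟩ := e y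
  exact ((hz _).trans e').trans (HomogeneousLocalization.val_mk
    (⟨i, ⟨a, ha⟩, ⟨b, hb⟩, hb'⟩ : HomogeneousLocalization.NumDenSameDeg (grading k n) _)).symm

end TwistedSections

/-! ### Points of `ℙⁿ` attached to primes and to lines of `V`. -/

section Points

/-- The point of `ℙⁿ` defined by the homogeneous elements of a prime ideal. -/
def pointOfPrime (J : Ideal (MvPolynomial (Fin (n + 1)) k)) (hJ : J.IsPrime)
    (h : ∃ i, MvPolynomial.X i ∉ J) : PSpace k n where
  asHomogeneousIdeal := J.homogeneousCore (grading k n)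
  isPrime := hJ.homogeneousCore
  not_irrelevant_le hle := by
    obtain ⟨i, hi⟩ := h
    refine hi (Ideal.toIdeal_homogeneousCore_le (grading k n) J (hle ?_))
    rw [HomogeneousIdeal.mem_irrelevant_iff, GradedRing.proj_apply,
      DirectSum.decompose_of_mem_ne (grading k n) (MvPolynomial.isHomogeneous_X k i) one_ne_zero]

theorem mem_primeOf_pointOfPrime {J : Ideal (MvPolynomial (Fin (n + 1)) k)} {hJ : J.IsPrime}
    {h : ∃ i, MvPolynomial.X i ∉ J} {d : ℕ} {f : MvPolynomial (Fin (n + 1)) k}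
    (hf : f ∈ grading k n d) : f ∈ primeOf (pointOfPrime J hJ h) ↔ f ∈ J :=
  ⟨fun h ↦ Ideal.toIdeal_homogeneousCore_le (grading k n) J h,
    fun h ↦ Ideal.mem_homogeneousCore_of_homogeneous_of_mem ⟨d, hf⟩ h⟩

theorem primeOf_pointOfPrime_le {J : Ideal (MvPolynomial (Fin (n + 1)) k)} {hJ : J.IsPrime}
    {h : ∃ i, MvPolynomial.X i ∉ J} : primeOf (pointOfPrime J hJ h) ≤ J :=
  Ideal.toIdeal_homogeneousCore_le (grading k n) J

/-- The smaller prime is a generization, and open sets are stable under generization. -/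
theorem mem_of_primeOf_le {x y : PSpace k n} (h : primeOf x ≤ primeOf y) {U : (PSpace k n).Opens}
    (hy : y ∈ U) : x ∈ U := by
  have : y ∈ closure {x} := (ProjectiveSpectrum.le_iff_mem_closure (𝒜 := grading k n) x y).mp h
  exact ((specializes_iff_mem_closure (x := x) (y := y)).mpr this).mem_open U.2 hy

/-- A line in `V` gives a point of `ℙⁿ` at whose residue field the coordinates `X_i` are
proportional to those of the line. -/
theorem exists_point_of_ne_zero {v : V k n} (hv : v ≠ 0) :
    ∃ (x : PSpace k n) (t : IsLocalRing.ResidueField (Loc x)), t ≠ 0 ∧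
      (∀ i, IsLocalRing.residue (Loc x) (coord x i) = v i • t) ∧
      ∀ i, v i ≠ 0 → MvPolynomial.X i ∉ primeOf x := by
  obtain ⟨j, hj⟩ := Function.ne_iff.mp hv
  simp only [Pi.zero_apply] at hj
  let φ : MvPolynomial (Fin (n + 1)) k →ₐ[k] k := MvPolynomial.aeval v
  have hX (i) : MvPolynomial.X i ∈ RingHom.ker φ ↔ v i = 0 := by simp [φ]
  -- The kernel of evaluation at `v` is not homogeneous; its homogeneous core is the ideal of the
  -- line.
  let x := pointOfPrime (RingHom.ker φ) (RingHom.ker_isPrime _) ⟨j, by rwa [hX]⟩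
  have hXx (i) : MvPolynomial.X i ∈ primeOf x ↔ v i = 0 := by
    rw [mem_primeOf_pointOfPrime (MvPolynomial.isHomogeneous_X k i), hX]
  let ρ : MvPolynomial (Fin (n + 1)) k →ₐ[k] IsLocalRing.ResidueField (Loc x) :=
    { (IsLocalRing.residue (Loc x)).comp (algebraMap (MvPolynomial (Fin (n + 1)) k) (Loc x)) with
      commutes' _ := rfl }
  have hρ (p) : ρ p = 0 ↔ p ∈ primeOf x := by
    change IsLocalRing.residue (Loc x) (algebraMap (MvPolynomial (Fin (n + 1)) k) (Loc x) p) = 0 ↔ _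
    rw [IsLocalRing.residue_eq_zero_iff,
      IsLocalization.AtPrime.to_map_mem_maximal_iff (Loc x) (primeOf x)]
  -- Here `t = X_j / v_j`; proportionality comes from the forms `v_j X_i - v_i X_j`, which vanish at
  -- `v`.
  refine ⟨x, (v j)⁻¹ • ρ (MvPolynomial.X j), ?_, fun i ↦ ?_, fun i hi ↦ by rwa [hXx]⟩
  · refine smul_ne_zero (inv_ne_zero hj) ?_
    rwa [Ne, hρ, hXx]
  · change ρ (MvPolynomial.X i) = _
    have h : v j • MvPolynomial.X i - v i • MvPolynomial.X j ∈ primeOf x := by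
      rw [mem_primeOf_pointOfPrime (d := 1) (sub_mem (Submodule.smul_mem _ _
        (MvPolynomial.isHomogeneous_X k i))
        (Submodule.smul_mem _ _ (MvPolynomial.isHomogeneous_X k j)))]
      simp [φ, mul_comm]
    rw [← hρ, map_sub, map_smul, map_smul, sub_eq_zero] at h
    rw [smul_comm, ← h, inv_smul_smul₀ hj]

end Points

/-! ### Global sections of `𝒪(d)`. -/

section GlobalSections

theorem algebraMap_Loc_injective (x : PSpace k n) :
    Function.Injective (algebraMap (MvPolynomial (Fin (n + 1)) k) (Loc x)) :=
  IsLocalization.injective _ (primeOf x).primeCompl_le_nonZeroDivisors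

/-- The degree `m` part of `f`, times `b`, is the degree `m + j` part of `a`, which is zero unless
`m = d`. -/
theorem isHomogeneous_of_mul {d i j : ℕ} {f a b : MvPolynomial (Fin (n + 1)) k}
    (ha : a ∈ grading k n i) (hb : b ∈ grading k n j) (hb0 : b ≠ 0) (h : f * b = a)
    (hij : i = j + d) : f ∈ grading k n d := by
  have key (m : ℕ) (hm : m ≠ d) : MvPolynomial.homogeneousComponent m f = 0 := by
    have h1 := DirectSum.coe_decompose_mul_of_right_mem_of_le (grading k n) (a := f) (n := m + j) hb
      (Nat.le_add_left _ _)
    rw [h, DirectSum.decompose_of_mem_ne (grading k n) ha (by omega)] at h1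
    rw [Nat.add_sub_cancel] at h1
    exact (MvPolynomial.decomposition.decompose'_apply f m).symm.trans
      ((mul_eq_zero.mp h1.symm).resolve_right hb0)
  have := MvPolynomial.sum_homogeneousComponent f
  rw [← this]
  refine sum_mem fun m _ ↦ ?_
  by_cases hm : m = d
  · subst hm
    exact MvPolynomial.homogeneousComponent_isHomogeneous m f
  · rw [key m hm]
    exact zero_mem _

/-- This makes `(π)` define a point of `ℙⁿ`. Otherwise `π` would be associated to `X_0`, which would
then divide `X_n`. -/
theorem exists_X_not_dvd (hn : 1 ≤ n) {π : MvPolynomial (Fin (n + 1)) k} (hπ : Irreducible π) :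
    ∃ i, MvPolynomial.X i ∉ Ideal.span {π} := by
  by_contra! H
  simp only [Ideal.mem_span_singleton] at H
  have h0 := (hπ.dvd_irreducible_iff_associated
    (MvPolynomial.X_prime (R := k) (i := (0 : Fin (n + 1)))).irreducible).mp (H 0)
  have h1 : MvPolynomial.X (R := k) (0 : Fin (n + 1)) ∣ MvPolynomial.X (Fin.last n) :=
    h0.symm.dvd.trans (H _)
  rw [MvPolynomial.X_dvd_X] at h1
  have := congrArg Fin.val h1
  simp at this
  omega

/-- The global sections of `𝒪(d)` are the homogeneous polynomials of degree `d`. -/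
theorem IsTwistedSection.exists_eq_algebraMap (hn : 1 ≤ n) {d : ℕ}
    {s : ∀ x : (⊤ : (PSpace k n).Opens), Loc x.1} (hs : IsTwistedSection d ⊤ s) :
    ∃ f ∈ grading k n d, ∀ x, s x = algebraMap (MvPolynomial (Fin (n + 1)) k) (Loc x.1) f := by
  -- The generic point lies in every nonempty open set, so all local fractions `a / b` can be
  -- compared there with one reduced fraction `p / q`.
  let η : PSpace k n := pointOfPrime ⊥ Ideal.isPrime_bot ⟨0, by simp⟩
  have hη (x : PSpace k n) : primeOf η ≤ primeOf x := primeOf_pointOfPrime_le.trans bot_le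
  obtain ⟨a₀, b₀, hb₀, e₀⟩ : ∃ a₀ b₀, ∃ hb : b₀ ∈ (primeOf η).primeCompl,
      s ⟨η, trivial⟩ = Localization.mk a₀ ⟨b₀, hb⟩ := by
    obtain ⟨U', hx, hU, i, j, a, b, ha, hb, hij, e⟩ := hs ⟨η, trivial⟩
    exact ⟨a, b, e ⟨η, hx⟩⟩
  have hb₀' : b₀ ≠ 0 := fun h ↦ hb₀ (h ▸ zero_mem _)
  obtain ⟨q, p, c, hqp, rfl, rfl⟩ := UniqueFactorizationMonoid.exists_reduced_factors b₀ hb₀' a₀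
  have hc : c ≠ 0 := left_ne_zero_of_mul hb₀'
  have key (x : (⊤ : (PSpace k n).Opens)) : ∃ (i j : ℕ) (a b : MvPolynomial (Fin (n + 1)) k),
      a ∈ grading k n i ∧ b ∈ grading k n j ∧ i = j + d ∧ a * q = p * b ∧
      ∃ hb : b ∈ (primeOf x.1).primeCompl, s x = Localization.mk a ⟨b, hb⟩ := by
    obtain ⟨U', hx, hU, i, j, a, b, ha, hb, hij, e⟩ := hs x
    refine ⟨i, j, a, b, ha, hb, by omega, ?_, e ⟨x, hx⟩⟩
    obtain ⟨hb', e'⟩ := e ⟨η, mem_of_primeOf_le (hη _) hx⟩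
    have h := e'.symm.trans e₀
    rw [Localization.mk_eq_mk', IsLocalization.mk'_eq_iff_eq,
      (algebraMap_Loc_injective η).eq_iff] at h
    apply mul_left_cancel₀ hc
    linear_combination h
  -- By reducedness `q` divides every denominator `b`. An irreducible factor `π` of `q` would place
  -- `b` in the prime of the point attached to `(π)`, where `b` has to be invertible.
  have hqu : IsUnit q := by
    by_contra hq
    obtain ⟨π, hπ, hπq⟩ := WfDvdMonoid.exists_irreducible_factor hq (right_ne_zero_of_mul hb₀')
    have hprime : (Ideal.span {π}).IsPrime :=
      (Ideal.span_singleton_prime hπ.ne_zero).mpr hπ.prime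
    obtain ⟨i, j, a, b, ha, hb, hij, h, hb', -⟩ :=
      key ⟨pointOfPrime (Ideal.span {π}) hprime (exists_X_not_dvd hn hπ), trivial⟩
    refine hb' ((mem_primeOf_pointOfPrime (hJ := hprime) (h := exists_X_not_dvd hn hπ) hb).mpr
      (Ideal.mem_span_singleton.mpr (hπq.trans ?_)))
    exact hqp.dvd_of_dvd_mul_left ⟨a, by rw [← h, mul_comm]⟩
  obtain ⟨q', hq'⟩ := hqu.exists_right_inv
  have key' {a b : MvPolynomial (Fin (n + 1)) k} (h : a * q = p * b) :
      p * q' * b = a := by linear_combination -q' * h + a * hq'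
  refine ⟨p * q', ?_, fun x ↦ ?_⟩
  · obtain ⟨i, j, a, b, ha, hb, hij, h, hb', -⟩ := key ⟨η, trivial⟩
    exact isHomogeneous_of_mul ha hb (fun h ↦ hb' (h ▸ zero_mem _)) (key' h) hij
  · obtain ⟨i, j, a, b, ha, hb, hij, h, hb', e⟩ := key x
    rw [e, Localization.mk_eq_mk', IsLocalization.mk'_eq_iff_eq_mul, ← map_mul, key' h]

end GlobalSections

/-! ### Sections of the sheaves as families of linear maps. -/

section Sections

variable {W W' : Type u} [AddCommGroup W] [Module k W] [AddCommGroup W'] [Module k W'] {l : ℤ}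
  {U U' : (PSpace k n).Opens}

/-- The family of linear maps underlying a section of `Hom_k(W, 𝒪(l))`. -/
def fam (s : Γ(twistHom k n W l, U)) (x : U) : W →ₗ[k] Loc x.1 :=
  Subtype.val (p := fun s ↦ s ∈ homSections W l U) s x

/-- The section of `Hom_k(W, 𝒪(l))` with a given underlying family of linear maps. -/
def mkSec (s : ∀ x : U, W →ₗ[k] Loc x.1) (hs : ∀ w, IsTwistedSection l U (fun x ↦ s x w)) :
    Γ(twistHom k n W l, U) :=
  (⟨s, hs⟩ : homSections W l U)

theorem isTwistedSection_fam (s : Γ(twistHom k n W l, U)) (w : W) :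
    IsTwistedSection l U (fun x ↦ fam s x w) :=
  Subtype.prop (p := fun s ↦ s ∈ homSections W l U) s w

theorem fam_mkSec (s : ∀ x : U, W →ₗ[k] Loc x.1) (hs : ∀ w, IsTwistedSection l U (fun x ↦ s x w))
    (x : U) : fam (mkSec s hs) x = s x := rfl

theorem fam_ext {s t : Γ(twistHom k n W l, U)} (h : ∀ x, fam s x = fam t x) : s = t :=
  Subtype.ext (p := fun s ↦ s ∈ homSections W l U) (funext h)

theorem fam_add (s t : Γ(twistHom k n W l, U)) (x : U) : fam (s + t) x = fam s x + fam t x := rfl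

theorem fam_zero (x : U) : fam (0 : Γ(twistHom k n W l, U)) x = 0 := rfl

theorem fam_smul (r : Γ(PSpace k n, U)) (s : Γ(twistHom k n W l, U)) (x : U) :
    fam (r • s) x = value r x • fam s x := rfl

theorem fam_map (i : U' ⟶ U) (s : Γ(twistHom k n W l, U)) (x : U') :
    fam ((twistHom k n W l).presheaf.map i.op s) x = fam s ⟨x.1, i.le x.2⟩ := rfl

theorem fam_precomp (g : W' →ₗ[k] W) (s : Γ(twistHom k n W l, U)) (x : U) :
    fam ((precomp g l).app U s) x = fam s x ∘ₗ g := rfl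

theorem fam_contract {p q m : ℕ} (h : p + q = m) (ω : ⋀[k]^p (V k n))
    (s : Γ(twistHom k n (⋀[k]^m (V k n)) l, U)) (x : U) :
    fam ((contract h ω l).app U s) x = fam s x ∘ₗ wedge h ω := rfl

/-- Contraction with the tautological vector `∑ i, X_i e_i` on the fibre at a point. -/
def contractX (q : ℕ) (x : PSpace k n) :
    (⋀[k]^(q + 1) (V k n) →ₗ[k] Loc x) →ₗ[Loc x] (⋀[k]^q (V k n) →ₗ[k] Loc x) :=
  ∑ i : Fin (n + 1), coord x i • precompFibre (wedge (Nat.add_comm 1 q) (basisVec k n i)) x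

theorem contractX_apply {q : ℕ} {x : PSpace k n} (α : ⋀[k]^(q + 1) (V k n) →ₗ[k] Loc x)
    (η : ⋀[k]^q (V k n)) : contractX q x α η =
      ∑ i, coord x i * α (wedge (Nat.add_comm 1 q) (basisVec k n i) η) := by
  simp only [contractX, LinearMap.sum_apply, LinearMap.smul_apply, smul_eq_mul, precompFibre_apply]

theorem fam_koszul {q : ℕ} (s : Γ(twistHom k n (⋀[k]^(q + 1) (V k n)) (l - 1), U)) (x : U) :
    fam ((koszul k n q l).app U s) x = contractX q x.1 (fam s x) := rfl

/-- The projection of `𝒪(l-1) ⊗ ⋀^{q+1} V^∨` onto `Ω^q(q + l)`. -/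
def Omega.proj (k : Type u) [Field k] (n : ℕ) (q : ℕ) (l : ℤ) :
    twistHom k n (⋀[k]^(q + 1) (V k n)) (l - 1) ⟶ Omega k n q l :=
  factorThruImage (koszul k n q l)

theorem Omega.proj_incl (q : ℕ) (l : ℤ) :
    Omega.proj k n q l ≫ Omega.incl k n q l = koszul k n q l :=
  image.fac _

instance (q : ℕ) (l : ℤ) : Epi (Omega.proj k n q l) :=
  inferInstanceAs (Epi (factorThruImage (koszul k n q l)))

instance (q : ℕ) (l : ℤ) : Mono (Omega.incl k n q l) :=
  inferInstanceAs (Mono (image.ι (koszul k n q l)))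

/-- The family of linear maps underlying a section of `Ω^q(q + l)`. -/
def Omega.fam {q : ℕ} (σ : Γ(Omega k n q l, U)) (x : U) : ⋀[k]^q (V k n) →ₗ[k] Loc x.1 :=
  ProjContraction.fam ((Omega.incl k n q l).app U σ) x

theorem Omega.isTwistedSection_fam {q : ℕ} (σ : Γ(Omega k n q l, U)) (η : ⋀[k]^q (V k n)) :
    IsTwistedSection l U (fun x ↦ Omega.fam σ x η) :=
  ProjContraction.isTwistedSection_fam _ _

theorem Omega.fam_ext {q : ℕ} {σ τ : Γ(Omega k n q l, U)}
    (h : ∀ x, Omega.fam σ x = Omega.fam τ x) : σ = τ :=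
  Scheme.Modules.app_injective_of_mono (Omega.incl k n q l) U (ProjContraction.fam_ext h)

theorem Omega.fam_map {q : ℕ} (i : U' ⟶ U) (σ : Γ(Omega k n q l, U)) (x : U') :
    Omega.fam ((Omega k n q l).presheaf.map i.op σ) x = Omega.fam σ ⟨x.1, i.le x.2⟩ := by
  rw [Omega.fam, Scheme.Modules.naturality_apply, ProjContraction.fam_map, Omega.fam]

theorem Omega.fam_proj {q : ℕ} (s : Γ(twistHom k n (⋀[k]^(q + 1) (V k n)) (l - 1), U)) (x : U) :
    Omega.fam ((Omega.proj k n q l).app U s) x = contractX q x.1 (ProjContraction.fam s x) := by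
  rw [← fam_koszul, ← Omega.proj_incl]
  rfl

theorem Omega.fam_contractOmega {p q m : ℕ} (h : p + q = m) (ω : ⋀[k]^p (V k n))
    (σ : Γ(Omega k n m l, U)) (x : U) :
    Omega.fam ((contractOmega h ω l).app U σ) x = Omega.fam σ x ∘ₗ wedge h ω := by
  rw [Omega.fam, Omega.fam, ← fam_contract]
  exact congr(ProjContraction.fam (($(congr(($(contractOmega_incl h ω l)).app U))) σ) x)

theorem Omega.exists_proj_eq {q : ℕ} (σ : Γ(Omega k n q l, U)) {x : PSpace k n} (hx : x ∈ U) :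
    ∃ (U' : (PSpace k n).Opens) (i : U' ⟶ U), x ∈ U' ∧
      ∃ s : Γ(twistHom k n (⋀[k]^(q + 1) (V k n)) (l - 1), U'),
        (Omega.proj k n q l).app U' s = (Omega k n q l).presheaf.map i.op σ :=
  Scheme.Modules.locally_surjective_of_epi (Omega.proj k n q l) U σ x hx

/-- A lift through `Omega.proj` exists only locally, which is enough for the value at one point. -/
theorem Omega.exists_contractX_eq {q : ℕ} (σ : Γ(Omega k n q l, U)) (x : U) :
    ∃ α, Omega.fam σ x = contractX q x.1 α := by
  obtain ⟨U', i, hx, s, hs⟩ := Omega.exists_proj_eq σ x.2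
  refine ⟨ProjContraction.fam s ⟨x.1, hx⟩, ?_⟩
  refine Eq.trans ?_ (Omega.fam_proj s ⟨x.1, hx⟩)
  rw [hs, Omega.fam_map]

end Sections

/-! ### Contraction with the tautological vector. -/

section Wedge

/-- A vector of `V`, as an element of `⋀¹ V`. -/
def vec (v : V k n) : ⋀[k]^1 (V k n) := exteriorPower.ιMulti k 1 ![v]

theorem coe_vec (v : V k n) : (vec v : ExteriorAlgebra k (V k n)) = ExteriorAlgebra.ι k v := by
  simp [vec, ExteriorAlgebra.ιMulti_apply]

theorem basisVec_eq_vec (i : Fin (n + 1)) : basisVec k n i = vec (Pi.single i 1) := rfl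

theorem coe_wedge {p q m : ℕ} (h : p + q = m) (ω : ⋀[k]^p (V k n)) (η : ⋀[k]^q (V k n)) :
    (wedge h ω η : ExteriorAlgebra k (V k n)) = ω * η := rfl

theorem sum_smul_wedge_basisVec (v : V k n) {q m : ℕ} (h : 1 + q = m) (η : ⋀[k]^q (V k n)) :
    ∑ i, v i • wedge h (basisVec k n i) η = wedge h (vec v) η := by
  apply Subtype.ext
  simp only [AddSubmonoidClass.coe_finsetSum, Submodule.coe_smul, coe_wedge, basisVec_eq_vec,
    coe_vec,
    ← smul_mul_assoc]
  simp only [← Finset.sum_mul, ← map_smul, ← map_sum]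
  congr 2
  ext j
  simp [Finset.sum_apply, Pi.single_apply]

theorem wedge_vec_vec_comm (v w : V k n) {q : ℕ} (η : ⋀[k]^q (V k n)) :
    wedge (Nat.add_comm 1 (q + 1)) (vec v) (wedge (Nat.add_comm 1 q) (vec w) η) =
      -wedge (Nat.add_comm 1 (q + 1)) (vec w) (wedge (Nat.add_comm 1 q) (vec v) η) := by
  apply Subtype.ext
  simp only [Submodule.coe_neg, coe_wedge, coe_vec, ← mul_assoc]
  rw [eq_neg_of_add_eq_zero_left (ExteriorAlgebra.ι_add_mul_swap v w), neg_mul]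

/-- The double sum is antisymmetric in its two indices, hence equal to its negative. -/
theorem contractX_contractX [CharZero k] {q : ℕ} {x : PSpace k n}
    (α : ⋀[k]^(q + 2) (V k n) →ₗ[k] Loc x) : contractX q x (contractX (q + 1) x α) = 0 := by
  refine LinearMap.ext fun η ↦ ?_
  have h : contractX q x (contractX (q + 1) x α) η =
      -contractX q x (contractX (q + 1) x α) η := by
    simp only [contractX_apply, Finset.mul_sum]
    conv_rhs => rw [Finset.sum_comm]
    rw [← Finset.sum_neg_distrib]
    refine Finset.sum_congr rfl fun i _ ↦ ?_
    rw [← Finset.sum_neg_distrib]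
    refine Finset.sum_congr rfl fun j _ ↦ ?_
    rw [basisVec_eq_vec, basisVec_eq_vec, wedge_vec_vec_comm, map_neg]
    ring
  have h2 : (2 : k) • contractX q x (contractX (q + 1) x α) η = 0 := by
    rw [two_smul]
    exact eq_neg_iff_add_eq_zero.mp h
  exact (smul_eq_zero.mp h2).resolve_left two_ne_zero

/-- The value at the point `[v]` of the contraction with the tautological vector is the contraction
with a multiple of `v`. -/
theorem residue_contractX {v : V k n} {x : PSpace k n} {t : IsLocalRing.ResidueField (Loc x)}
    (hx : ∀ i, IsLocalRing.residue (Loc x) (coord x i) = v i • t) {q : ℕ}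
    (α : ⋀[k]^(q + 1) (V k n) →ₗ[k] Loc x) (η : ⋀[k]^q (V k n)) :
    IsLocalRing.residue (Loc x) (contractX q x α η) =
      t * IsLocalRing.residue (Loc x) (α (wedge (Nat.add_comm 1 q) (vec v) η)) := by
  have hr (c : k) (z : Loc x) :
      IsLocalRing.residue (Loc x) (c • z) = c • IsLocalRing.residue (Loc x) z := rfl
  rw [contractX_apply, ← sum_smul_wedge_basisVec, map_sum, map_sum, map_sum, Finset.mul_sum]
  refine Finset.sum_congr rfl fun i _ ↦ ?_
  rw [map_mul, hx, map_smul, hr, smul_mul_assoc, mul_smul_comm]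

end Wedge

/-! ### Contraction with linear forms and Euler's formula. -/

section Contraction

theorem contractLeft_ι_mul (d : Module.Dual k (V k n)) (v : V k n) (y : ExteriorAlgebra k (V k n)) :
    CliffordAlgebra.contractLeft (Q := (0 : QuadraticForm k (V k n))) d
      (ExteriorAlgebra.ι k v * y) = d v • y - ExteriorAlgebra.ι k v *
        CliffordAlgebra.contractLeft (Q := (0 : QuadraticForm k (V k n))) d y :=
  CliffordAlgebra.contractLeft_ι_mul (Q := (0 : QuadraticForm k (V k n))) d v y

theorem contractLeft_mem (d : Module.Dual k (V k n)) (q : ℕ) : ∀ x ∈ ⋀[k]^(q + 1) (V k n),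
    CliffordAlgebra.contractLeft (Q := (0 : QuadraticForm k (V k n))) d x ∈ ⋀[k]^q (V k n) := by
  induction q with
  | zero =>
    intro x hx
    rw [ExteriorAlgebra.exteriorPower, zero_add, pow_one] at hx
    obtain ⟨v, rfl⟩ := hx
    rw [ExteriorAlgebra.exteriorPower, pow_zero]
    refine Submodule.mem_one.mpr ⟨d v, ?_⟩
    exact (CliffordAlgebra.contractLeft_ι (0 : QuadraticForm k (V k n)) d v).symm
  | succ q ih =>
    intro x hx
    rw [ExteriorAlgebra.exteriorPower, pow_succ'] at hx
    induction hx using Submodule.mul_induction_on' with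
    | mem_mul_mem a ha y hy =>
      obtain ⟨v, rfl⟩ := ha
      rw [contractLeft_ι_mul]
      refine sub_mem (Submodule.smul_mem _ _ hy) ?_
      rw [ExteriorAlgebra.exteriorPower, pow_succ']
      exact Submodule.mul_mem_mul ⟨v, rfl⟩ (ih y hy)
    | add x _ y _ hx hy => rw [map_add]; exact add_mem hx hy

/-- The operator is the derivation that extends the identity of `V`, so it has weight `q` on `⋀^q
V`. It gives both the Koszul homotopy and the weight in the Lefschetz relation. -/
theorem sum_ι_mul_contractLeft {ι : Type*} [Fintype ι] (b : Module.Basis ι k (V k n))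
    (q : ℕ) : ∀ x ∈ ⋀[k]^q (V k n),
    ∑ i, ExteriorAlgebra.ι k (b i) *
      CliffordAlgebra.contractLeft (Q := (0 : QuadraticForm k (V k n))) (b.coord i) x =
      (q : k) • x := by
  induction q with
  | zero =>
    intro x hx
    rw [ExteriorAlgebra.exteriorPower, pow_zero] at hx
    obtain ⟨c, rfl⟩ := hx
    simp
  | succ q ih =>
    intro x hx
    rw [ExteriorAlgebra.exteriorPower, pow_succ'] at hx
    induction hx using Submodule.mul_induction_on' with
    | mem_mul_mem a ha y hy =>
      obtain ⟨v, rfl⟩ := ha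
      have hv : ∑ i, b.coord i v • ExteriorAlgebra.ι k (b i) = ExteriorAlgebra.ι k v := by
        simp only [← map_smul, ← map_sum, Module.Basis.coord_apply, b.sum_repr]
      have (i : ι) : ExteriorAlgebra.ι k (b i) *
          CliffordAlgebra.contractLeft (Q := (0 : QuadraticForm k (V k n))) (b.coord i)
            (ExteriorAlgebra.ι k v * y) =
          b.coord i v • ExteriorAlgebra.ι k (b i) * y + ExteriorAlgebra.ι k v *
            (ExteriorAlgebra.ι k (b i) *
              CliffordAlgebra.contractLeft (Q := (0 : QuadraticForm k (V k n)))
                (b.coord i) y) := by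
        rw [contractLeft_ι_mul, mul_sub, ← mul_assoc, ← mul_assoc, sub_eq_add_neg, ← neg_mul,
          ← eq_neg_of_add_eq_zero_left (ExteriorAlgebra.ι_add_mul_swap v (b i))]
        simp only [smul_mul_assoc, mul_smul_comm]
      simp only [this]
      rw [Finset.sum_add_distrib, ← Finset.sum_mul, hv, ← Finset.mul_sum, ih y hy, mul_smul_comm,
        Nat.cast_succ, add_smul, one_smul]
      exact add_comm _ _
    | add x _ y _ hx hy => simp only [map_add, mul_add, Finset.sum_add_distrib, smul_add, hx, hy]

/-- Contraction of exterior powers of `V` with a linear form. -/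
def contr (d : Module.Dual k (V k n)) (q : ℕ) : ⋀[k]^(q + 1) (V k n) →ₗ[k] ⋀[k]^q (V k n) :=
  (CliffordAlgebra.contractLeft (Q := (0 : QuadraticForm k (V k n))) d).restrict
    (contractLeft_mem d q)

theorem coe_contr (d : Module.Dual k (V k n)) (q : ℕ) (η : ⋀[k]^(q + 1) (V k n)) :
    (contr d q η : ExteriorAlgebra k (V k n)) =
      CliffordAlgebra.contractLeft (Q := (0 : QuadraticForm k (V k n))) d η := rfl

theorem contr_wedge_vec (d : Module.Dual k (V k n)) (q : ℕ) (v : V k n) (η : ⋀[k]^(q + 1) (V k n)) :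
    contr d (q + 1) (wedge (Nat.add_comm 1 _) (vec v) η) =
      d v • η - wedge (Nat.add_comm 1 _) (vec v) (contr d q η) := by
  apply Subtype.ext
  rw [Submodule.coe_sub, Submodule.coe_smul, coe_wedge, coe_contr, coe_contr, coe_wedge, coe_vec]
  exact contractLeft_ι_mul _ _ _

theorem sum_wedge_basisVec_contr (q : ℕ) (η : ⋀[k]^(q + 1) (V k n)) :
    ∑ i, wedge (Nat.add_comm 1 q) (basisVec k n i) (contr (LinearMap.proj i) q η) =
      ((q + 1 : ℕ) : k) • η := by
  apply Subtype.ext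
  have h := sum_ι_mul_contractLeft (Pi.basisFun k _) (q + 1) (η : ExteriorAlgebra k (V k n)) η.2
  refine Eq.trans ?_ h
  have hb (i : Fin (n + 1)) : (Pi.basisFun k (Fin (n + 1))).coord i = LinearMap.proj i := rfl
  simp only [AddSubmonoidClass.coe_finsetSum, coe_wedge, basisVec_eq_vec, coe_vec, coe_contr, hb,
    Pi.basisFun_apply]

end Contraction

section

variable {W : Type u} [AddCommGroup W] [Module k W]

/-! ### Constant forms and families of polynomials. -/

section Constant

/-- A `k`-linear form, viewed as a linear map to the localization at a point. -/
def constMap (α : W →ₗ[k] k) (x : PSpace k n) : W →ₗ[k] Loc x := Algebra.linearMap k (Loc x) ∘ₗ α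

theorem constMap_apply (α : W →ₗ[k] k) (x : PSpace k n) (w : W) :
    constMap α x w = algebraMap k (Loc x) (α w) := rfl

theorem isTwistedSection_constMap (α : W →ₗ[k] k) {l : ℤ} (hl : l = 0) (U : (PSpace k n).Opens)
    (w : W) : IsTwistedSection l U (fun x ↦ constMap α x.1 w) := by
  subst hl
  exact IsTwistedSection.polynomial U (MvPolynomial.isHomogeneous_C _ (α w))

theorem algebraMap_Loc_smul (x : PSpace k n) (c : k) (p : MvPolynomial (Fin (n + 1)) k) :
    algebraMap (MvPolynomial (Fin (n + 1)) k) (Loc x) (c • p) =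
      c • algebraMap (MvPolynomial (Fin (n + 1)) k) (Loc x) p :=
  map_smul (IsScalarTower.toAlgHom k (MvPolynomial (Fin (n + 1)) k) (Loc x)) c p

theorem eq_zero_of_sum_coord_mul_eq_zero {x : PSpace k n} {c : Fin (n + 1) → k}
    (h : ∑ i, coord x i * algebraMap k (Loc x) (c i) = 0) : c = 0 := by
  have h1 : ∑ i, c i • MvPolynomial.X (R := k) i = 0 := by
    apply algebraMap_Loc_injective x
    rw [map_zero, ← h, map_sum]
    refine Finset.sum_congr rfl fun i _ ↦ ?_
    rw [algebraMap_Loc_smul, Algebra.smul_def, mul_comm]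
  ext j
  simpa [Pi.single_apply, MvPolynomial.smul_eval] using
    congrArg (MvPolynomial.eval (Pi.single j (1 : k))) h1

theorem eq_sum_smul_X {f : MvPolynomial (Fin (n + 1)) k} (hf : f ∈ grading k n 1) :
    f = ∑ i, MvPolynomial.eval (Pi.single i 1) f • MvPolynomial.X i := by
  rw [grading, MvPolynomial.homogeneousSubmodule_one_eq_span_X] at hf
  induction hf using Submodule.span_induction with
  | mem f hf =>
    obtain ⟨j, rfl⟩ := hf
    simp [Pi.single_apply]
  | zero => simp
  | add f g _ _ hf hg =>
    simp only [map_add, add_smul, Finset.sum_add_distrib]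
    rw [← hf, ← hg]
  | smul c f _ hf =>
    conv_lhs => rw [hf]
    simp [Finset.smul_sum, MvPolynomial.smul_eval, mul_smul]

/-- Linearity of the chosen polynomials in `w` is tested in a single localization, into which the
polynomial ring embeds. -/
theorem exists_polynomial_family (hn : 1 ≤ n) {d : ℕ}
    (s : ∀ x : (⊤ : (PSpace k n).Opens), W →ₗ[k] Loc x.1)
    (hs : ∀ w, IsTwistedSection d ⊤ (fun x ↦ s x w)) :
    ∃ σ : W →ₗ[k] MvPolynomial (Fin (n + 1)) k, (∀ w, σ w ∈ grading k n d) ∧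
      ∀ x w, s x w = algebraMap (MvPolynomial (Fin (n + 1)) k) (Loc x.1) (σ w) := by
  choose σ hσ h using fun w ↦ (hs w).exists_eq_algebraMap hn
  let x : PSpace k n := pointOfPrime ⊥ Ideal.isPrime_bot ⟨0, by simp⟩
  refine ⟨{ toFun := σ, map_add' := fun w w' ↦ ?_, map_smul' := fun c w ↦ ?_ }, hσ, fun x w ↦ h w x⟩
  · apply algebraMap_Loc_injective x
    rw [map_add, ← h _ ⟨x, trivial⟩, ← h _ ⟨x, trivial⟩, ← h _ ⟨x, trivial⟩, map_add]
  · apply algebraMap_Loc_injective x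
    rw [RingHom.id_apply, algebraMap_Loc_smul, ← h _ ⟨x, trivial⟩, ← h _ ⟨x, trivial⟩, map_smul]

end Constant

/-! ### Exactness of the Koszul complex and global sections of `Ω^q(q + 1)`. -/

section Koszul

variable {q : ℕ} {x : PSpace k n}

/-- A form on `⋀^{q+1} V` whose contraction with the tautological vector vanishes is zero. -/
theorem eq_zero_of_contractX_constMap [CharZero k] {α : ⋀[k]^(q + 1) (V k n) →ₗ[k] k}
    (h : contractX q x (constMap α x) = 0) : α = 0 := by
  have key (i : Fin (n + 1)) (η : ⋀[k]^q (V k n)) :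
      α (wedge (Nat.add_comm 1 q) (basisVec k n i) η) = 0 := by
    have h1 := LinearMap.congr_fun h η
    rw [contractX_apply] at h1
    exact congrFun (eq_zero_of_sum_coord_mul_eq_zero h1) i
  refine LinearMap.ext fun ζ ↦ ?_
  -- Euler's formula writes every `(q + 1)`-vector as a combination of products `e_i ∧ *`.
  have h1 := congrArg α (sum_wedge_basisVec_contr q ζ)
  simp only [map_sum, key, Finset.sum_const_zero, map_smul] at h1
  exact (smul_eq_zero.mp h1.symm).resolve_left (Nat.cast_ne_zero.mpr q.succ_ne_zero)

/-- The contracting homotopy of the Koszul complex where `X_j` is invertible. Contracting `e_i ∧ η`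
with the `j`-th coordinate gives `δ_ij η - e_i ∧ contr η`, and the second terms add up to a value of
`contractX q x β`. -/
theorem contractX_comp_contr {β : ⋀[k]^(q + 1) (V k n) →ₗ[k] Loc x} (hβ : contractX q x β = 0)
    {j : Fin (n + 1)} (hj : MvPolynomial.X j ∉ primeOf x) :
    contractX (q + 1) x (invX j x • (β ∘ₗ contr (LinearMap.proj j) (q + 1))) = β := by
  refine LinearMap.ext fun η ↦ ?_
  have h1 := LinearMap.congr_fun hβ (contr (LinearMap.proj j) q η)
  rw [contractX_apply] at h1
  rw [contractX_apply]
  simp only [LinearMap.smul_apply, LinearMap.comp_apply, basisVec_eq_vec, contr_wedge_vec, map_sub,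
    LinearMap.proj_apply, Pi.single_apply, smul_eq_mul, ite_smul, one_smul, zero_smul]
  simp only [mul_sub, Finset.sum_sub_distrib, mul_left_comm (coord x _), ← Finset.mul_sum]
  simp only [basisVec_eq_vec] at h1
  rw [h1]
  simp only [LinearMap.zero_apply, mul_zero, sub_zero, apply_ite β, map_zero, mul_ite,
    Finset.sum_ite_eq, Finset.mem_univ, if_true]
  rw [← mul_assoc, mul_comm (invX j x), X_mul_invX hj, one_mul]

/-- Exactness in degree one of the Koszul complex of the polynomial ring. -/
theorem exists_contraction_eq [CharZero k] {p : ℕ}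
    (σ : ⋀[k]^(p + 1) (V k n) →ₗ[k] MvPolynomial (Fin (n + 1)) k)
    (hσ : ∀ η, σ η ∈ grading k n 1)
    (h : ∀ η, ∑ i, MvPolynomial.X i * σ (wedge (Nat.add_comm 1 p) (basisVec k n i) η) = 0) :
    ∃ α : ⋀[k]^(p + 2) (V k n) →ₗ[k] k, ∀ η,
      σ η = ∑ i, α (wedge (Nat.add_comm 1 (p + 1)) (basisVec k n i) η) • MvPolynomial.X i := by
  let τ (i : Fin (n + 1)) : ⋀[k]^(p + 1) (V k n) →ₗ[k] k :=
    (MvPolynomial.aeval (Pi.single i (1 : k))).toLinearMap ∘ₗ σ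
  have hτ (η) : σ η = ∑ i, τ i η • MvPolynomial.X i := by
    refine (eq_sum_smul_X (hσ η)).trans ?_
    simp [τ, MvPolynomial.aeval_eq_eval]
  -- For fixed `η` the hypothesis says that the bilinear form with entries `τ_j(e_i ∧ η)` is
  -- alternating; `e_i` and `e_i + e_j` serve as test vectors.
  have hsum (η) (v : V k n) :
      ∑ i, v i * ∑ j, τ j (wedge (Nat.add_comm 1 p) (basisVec k n i) η) * v j = 0 := by
    have := congrArg (MvPolynomial.eval v) (h η)
    simpa [hτ, MvPolynomial.smul_eval] using this
  have hdiag (η) (i) : τ i (wedge (Nat.add_comm 1 p) (basisVec k n i) η) = 0 := by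
    simpa [Pi.single_apply] using hsum η (Pi.single i 1)
  have hswap (η) (i j) : τ j (wedge (Nat.add_comm 1 p) (basisVec k n i) η) =
      -τ i (wedge (Nat.add_comm 1 p) (basisVec k n j) η) := by
    have := hsum η (Pi.single i 1 + Pi.single j 1)
    simp [Pi.single_apply, add_mul, mul_add, Finset.sum_add_distrib, hdiag] at this
    linear_combination this
  -- On `e_j ∧ η` the Leibniz rule gives `τ_j η` once directly and `p + 1` times through `hswap` and
  -- Euler's formula, hence the factor `1 / (p + 2)`.
  refine ⟨((p + 2 : ℕ) : k)⁻¹ • ∑ i, τ i ∘ₗ contr (LinearMap.proj i) (p + 1), fun η ↦ ?_⟩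
  rw [hτ η]
  refine Finset.sum_congr rfl fun j _ ↦ ?_
  congr 1
  have h1 := congrArg (τ j) (sum_wedge_basisVec_contr p η)
  rw [map_sum, map_smul] at h1
  have h2 (i) : τ i (contr (LinearMap.proj i) (p + 1)
      (wedge (Nat.add_comm 1 (p + 1)) (basisVec k n j) η)) = (if j = i then τ i η else 0) +
      τ j (wedge (Nat.add_comm 1 p) (basisVec k n i) (contr (LinearMap.proj i) p η)) := by
    rw [basisVec_eq_vec, contr_wedge_vec, map_sub, ← basisVec_eq_vec, hswap _ i j, sub_eq_add_neg]
    congr 1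
    simp only [LinearMap.proj_apply, Pi.single_apply, eq_comm (a := i)]
    split_ifs <;> simp
  simp only [LinearMap.smul_apply, LinearMap.sum_apply, LinearMap.comp_apply, h2,
    Finset.sum_add_distrib, h1]
  rw [Finset.sum_ite_eq, if_pos (Finset.mem_univ _), smul_eq_mul, smul_eq_mul,
    eq_inv_mul_iff_mul_eq₀ (Nat.cast_ne_zero.mpr (by omega))]
  push_cast
  ring

/-- The global sections of `Ω^q(q + 1)` for `q > 0` come from `⋀^{q+1} V^∨`. -/
theorem Omega.exists_fam_eq_contractX_constMap [CharZero k] (hn : 1 ≤ n) {p : ℕ}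
    (σ : Γ(Omega k n (p + 1) 1, ⊤)) : ∃ α : ⋀[k]^(p + 2) (V k n) →ₗ[k] k,
      ∀ x, Omega.fam σ x = contractX (p + 1) x.1 (constMap α x.1) := by
  obtain ⟨τ, hτ, h⟩ := exists_polynomial_family (d := 1) hn (fun x ↦ Omega.fam σ x)
    (fun η ↦ Omega.isTwistedSection_fam σ η)
  let x : PSpace k n := pointOfPrime ⊥ Ideal.isPrime_bot ⟨0, by simp⟩
  obtain ⟨α, hα⟩ := exists_contraction_eq τ hτ fun η ↦ by
    apply algebraMap_Loc_injective x
    obtain ⟨β, hβ⟩ := Omega.exists_contractX_eq σ ⟨x, trivial⟩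
    have h1 := LinearMap.congr_fun (contractX_contractX β) η
    rw [← hβ, contractX_apply] at h1
    simp only [h] at h1
    rw [map_sum, map_zero]
    simp only [map_mul]
    exact h1
  refine ⟨α, fun x ↦ LinearMap.ext fun η ↦ ?_⟩
  rw [h, hα, contractX_apply, map_sum]
  refine Finset.sum_congr rfl fun i _ ↦ ?_
  rw [algebraMap_Loc_smul, Algebra.smul_def, mul_comm, constMap_apply]

end Koszul

end

/-! ### Exterior multiplication by a bivector. -/

section WedgeTwo

theorem vec_smul (c : k) (v : V k n) : vec (c • v) = c • vec v :=
  Subtype.ext <| by simp only [Submodule.coe_smul, coe_vec, map_smul]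

theorem sum_smul_basisVec (v : V k n) : ∑ i, v i • basisVec k n i = vec v := by
  have h := sum_smul_wedge_basisVec v (Nat.add_zero 1)
    (⟨1, by
      rw [ExteriorAlgebra.exteriorPower, pow_zero]
      exact Submodule.mem_one.mpr ⟨1, map_one _⟩⟩ :
      ⋀[k]^0 (V k n))
  apply Subtype.ext
  have h' := congrArg Subtype.val h
  simpa [coe_wedge] using h'

theorem exists_eq_vec (η : ⋀[k]^1 (V k n)) : ∃ v, η = vec v := by
  obtain ⟨x, hx⟩ := η
  have hx' := hx
  rw [ExteriorAlgebra.exteriorPower, pow_one] at hx'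
  obtain ⟨v, rfl⟩ := hx'
  exact ⟨v, Subtype.ext (coe_vec v).symm⟩

/-- The canonical isomorphism from `⋀¹ V` to `V`. -/
def toV : ⋀[k]^1 (V k n) →ₗ[k] V k n := ExteriorAlgebra.ιInv ∘ₗ Submodule.subtype _

theorem toV_vec (v : V k n) : toV (vec v) = v := by
  simp only [toV, LinearMap.comp_apply, Submodule.subtype_apply, coe_vec]
  exact ExteriorAlgebra.ι_leftInverse v

theorem vec_eq_zero {v : V k n} : vec v = 0 ↔ v = 0 := by
  refine ⟨fun h ↦ ?_, fun h ↦ ?_⟩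
  · rw [← toV_vec v, h, map_zero]
  · rw [h, ← zero_smul k (0 : V k n), vec_smul, zero_smul]

theorem wedge_vec_comm {m : ℕ} (h : 1 + 2 = m) (h' : 2 + 1 = m) (ω : ⋀[k]^2 (V k n)) (v : V k n) :
    wedge h (vec v) ω = wedge h' ω (vec v) := by
  apply Subtype.ext
  rw [coe_wedge, coe_wedge, ← sum_smul_basisVec]
  simp only [AddSubmonoidClass.coe_finsetSum, Submodule.coe_smul, Finset.sum_mul, Finset.mul_sum,
    smul_mul_assoc, mul_smul_comm, basisVec_mul, neg_one_sq, one_smul]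

theorem wedge_wedge_vec (ω : ⋀[k]^2 (V k n)) (v : V k n) {q : ℕ} (η : ⋀[k]^q (V k n)) :
    wedge (Nat.add_comm 1 (2 + q)) (vec v) (wedge rfl ω η) =
      wedge (show 2 + (q + 1) = 2 + q + 1 from rfl) ω (wedge (Nat.add_comm 1 q) (vec v) η) := by
  have h := congrArg Subtype.val (wedge_vec_comm rfl rfl ω v)
  simp only [coe_wedge] at h
  apply Subtype.ext
  simp only [coe_wedge, ← mul_assoc]
  rw [h]

/-- A bivector commutes with vectors, so contraction with `ω` lifts through the Koszul differential
without a sign. -/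
theorem contractX_comp_wedge (ω : ⋀[k]^2 (V k n)) {q m : ℕ} (h : 2 + q = m)
    (h' : 2 + (q + 1) = m + 1) {x : PSpace k n} (α : ⋀[k]^(m + 1) (V k n) →ₗ[k] Loc x) :
    contractX q x (α ∘ₗ wedge h' ω) = contractX m x α ∘ₗ wedge h ω := by
  subst h
  refine LinearMap.ext fun η ↦ ?_
  rw [LinearMap.comp_apply, contractX_apply, contractX_apply]
  simp only [LinearMap.comp_apply, basisVec_eq_vec, wedge_wedge_vec]

end WedgeTwo

/-! ### When `ψ` is an epimorphism. -/

section Structure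

theorem fam_contractStructure {p : ℕ} (ω : ⋀[k]^p (V k n)) {l : ℤ} {U : (PSpace k n).Opens}
    (σ : Γ(Omega k n p l, U)) (x : U) (c : k) :
    fam ((contractStructure ω l).app U σ) x c = c • Omega.fam σ x ω :=
  map_smul (Omega.fam σ x) c ω

theorem contractStructure_app_eq_zero {p : ℕ} (ω : ⋀[k]^p (V k n)) {l : ℤ}
    {U : (PSpace k n).Opens} {σ : Γ(Omega k n p l, U)} :
    (contractStructure ω l).app U σ = 0 ↔ ∀ x, Omega.fam σ x ω = 0 := by
  refine ⟨fun h x ↦ ?_, fun h ↦ fam_ext fun x ↦ LinearMap.ext fun c ↦ ?_⟩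
  · rw [← one_smul k (Omega.fam σ x ω), ← fam_contractStructure, h]
    rfl
  · rw [fam_contractStructure, h, smul_zero]
    rfl

/-- The linear forms on `⋀³ V` which extend the coordinate functions along `v ↦ ω ∧ v`. -/
theorem sum_coord_mul_extension {ω : ⋀[k]^2 (V k n)} {g : ⋀[k]^3 (V k n) →ₗ[k] ⋀[k]^1 (V k n)}
    (hg : g ∘ₗ wedge (show 2 + 1 = 3 from rfl) ω = LinearMap.id) (j : Fin (n + 1))
    (x : PSpace k n) :
    contractX 2 x (constMap (LinearMap.proj j ∘ₗ toV ∘ₗ g) x) ω = coord x j := by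
  rw [contractX_apply]
  have h (i : Fin (n + 1)) : constMap (LinearMap.proj j ∘ₗ toV ∘ₗ g) x
      (wedge (Nat.add_comm 1 2) (basisVec k n i) ω) = if i = j then 1 else 0 := by
    rw [constMap_apply, basisVec_eq_vec, wedge_vec_comm _ rfl]
    simp only [LinearMap.comp_apply]
    have := LinearMap.congr_fun hg (vec (Pi.single i 1))
    simp only [LinearMap.comp_apply, LinearMap.id_apply] at this
    rw [this, toV_vec, LinearMap.proj_apply, Pi.single_apply, apply_ite (algebraMap k (Loc x)),
      map_one, map_zero]
    simp only [eq_comm]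
  simp only [h, mul_ite, mul_one, mul_zero, Finset.sum_ite_eq', Finset.mem_univ, if_true]

theorem epi_contractStructure_iff (ω : ⋀[k]^2 (V k n)) :
    Epi (contractStructure ω 0) ↔
      Function.Injective (wedge (show 2 + 1 = 3 from rfl) ω : ⋀[k]^1 (V k n) →ₗ[k] _) := by
  constructor
  · intro _
    rw [injective_iff_map_eq_zero]
    intro η hη
    obtain ⟨v, rfl⟩ := exists_eq_vec η
    rw [vec_eq_zero]
    by_contra hv
    obtain ⟨x, t, -, hx, -⟩ := exists_point_of_ne_zero hv
    -- If `ω ∧ v = 0`, every value of `ψ` vanishes in the residue field at `[v]`, so the section `1`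
    -- has no preimage near that point.
    let one : Γ(twistedSheaf k n 0, ⊤) := mkSec (fun x ↦ constMap LinearMap.id x.1)
      (isTwistedSection_constMap _ rfl ⊤)
    obtain ⟨U, i, hxU, σ, hσ⟩ :=
      Scheme.Modules.locally_surjective_of_epi (contractStructure ω 0) ⊤ one x trivial
    obtain ⟨α, hα⟩ := Omega.exists_contractX_eq σ ⟨x, hxU⟩
    have h1 : fam ((contractStructure ω 0).app U σ) ⟨x, hxU⟩ (1 : k) = 1 := by
      rw [hσ, fam_map, fam_mkSec, constMap_apply, LinearMap.id_apply, map_one]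
    rw [fam_contractStructure, one_smul, hα] at h1
    have h2 := residue_contractX hx α ω
    rw [wedge_vec_comm _ rfl, hη, map_zero, map_zero, mul_zero, h1, map_one] at h2
    exact one_ne_zero h2
  · intro h
    obtain ⟨g, hg⟩ := LinearMap.exists_leftInverse_of_injective _ (LinearMap.ker_eq_bot.mpr h)
    refine Scheme.Modules.epi_of_locally_surjective _ fun U t x hx ↦ ?_
    obtain ⟨j, hj⟩ := exists_X_notMem x
    let U' := U ⊓ Proj.basicOpen (grading k n) (MvPolynomial.X j)
    -- Lifts have coefficients in `𝒪(-1)`: the factor `X_j⁻¹` fixes the degree and cancels the `X_j`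
    -- given by `sum_coord_mul_extension`.
    let s : Γ(twistHom k n (⋀[k]^(2 + 1) (V k n)) (0 - 1), U') :=
      mkSec (fun y ↦ (invX j y.1 * fam t ⟨y.1, y.2.1⟩ (1 : k)) •
        constMap (LinearMap.proj j ∘ₗ toV ∘ₗ g) y.1) fun w ↦ by
          refine IsTwistedSection.mul (add_zero _) ?_ (isTwistedSection_constMap _ rfl U' w)
          exact IsTwistedSection.mul (l := -1) (l' := 0) rfl (IsTwistedSection.invX inf_le_right)
            ((isTwistedSection_fam t (1 : k)).res inf_le_left)
    refine ⟨U', homOfLE inf_le_left, ⟨hx, hj⟩, (Omega.proj k n 2 0).app U' s, ?_⟩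
    refine fam_ext fun y ↦ LinearMap.ext_ring ?_
    rw [fam_contractStructure, one_smul, Omega.fam_proj, fam_mkSec, map_smul, LinearMap.smul_apply,
      sum_coord_mul_extension hg, smul_eq_mul, mul_right_comm, mul_comm (invX _ _),
      X_mul_invX y.2.2, one_mul]
    rfl

end Structure

/-! ### When `φ` is an epimorphism. -/

section Lefschetz

variable (ω : ⋀[k]^2 (V k n))

/-- If `s` is a local lift of `τ` and `g` a retraction of `ω ∧ *`, then `s ∘ g` is a lift of a
preimage of `τ`. -/
theorem epi_contractOmega_of_injective
    (hω : Function.Injective (wedge (show 2 + 2 = 4 from rfl) ω : ⋀[k]^2 (V k n) →ₗ[k] _)) :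
    Epi (contractOmega (show 2 + 1 = 3 from rfl) ω 0) := by
  obtain ⟨g, hg⟩ := LinearMap.exists_leftInverse_of_injective _ (LinearMap.ker_eq_bot.mpr hω)
  refine Scheme.Modules.epi_of_locally_surjective _ fun U τ x hx ↦ ?_
  obtain ⟨U', i, hxU', s, hs⟩ := Omega.exists_proj_eq τ hx
  let s' : Γ(twistHom k n (⋀[k]^(3 + 1) (V k n)) (0 - 1), U') := (precomp g _).app U' s
  refine ⟨U', i, hxU', (Omega.proj k n 3 0).app U' s', ?_⟩
  rw [← hs]
  refine Omega.fam_ext fun y ↦ ?_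
  rw [Omega.fam_contractOmega, Omega.fam_proj,
    ← contractX_comp_wedge ω (show 2 + 1 = 3 from rfl) (show 2 + (1 + 1) = 3 + 1 from rfl),
    Omega.fam_proj,
    fam_precomp]
  exact congrArg _ (by rw [LinearMap.comp_assoc, hg, LinearMap.comp_id])

theorem exists_dual_eq_one {W : Type u} [AddCommGroup W] [Module k W] {w : W} (hw : w ≠ 0) :
    ∃ γ : W →ₗ[k] k, γ w = 1 := by
  by_contra! h
  refine hw ((Module.forall_dual_apply_eq_zero_iff k w).mp fun f ↦ ?_)
  by_contra hf
  exact h ((f w)⁻¹ • f) (inv_mul_cancel₀ hf)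

theorem isUnit_invX {j : Fin (n + 1)} {x : PSpace k n} (hx : MvPolynomial.X j ∉ primeOf x) :
    IsUnit (invX j x) :=
  IsUnit.of_mul_eq_one _ ((mul_comm _ _).trans (X_mul_invX hx))

/-- At `[v]`, sections in the image of `φ` take on `w` multiples of values at `ω ∧ v ∧ w`, here
zero, whereas `Ω¹(1)` has a local section with nonzero value on `w` as soon as `v ∧ w ≠ 0`. -/
theorem wedge_vec_eq_zero_of_epi [Epi (contractOmega (show 2 + 1 = 3 from rfl) ω 0)] {v w : V k n}
    (h : wedge (show 2 + 2 = 4 from rfl) ω (wedge (Nat.add_comm 1 1) (vec v) (vec w)) = 0) :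
    wedge (Nat.add_comm 1 1) (vec v) (vec w) = 0 := by
  by_contra hvw
  have hv : v ≠ 0 := by
    rintro rfl
    refine hvw (Subtype.ext ?_)
    rw [coe_wedge, coe_vec, map_zero, zero_mul]
    rfl
  obtain ⟨γ, hγ⟩ := exists_dual_eq_one (k := k) hvw
  obtain ⟨j, hj⟩ := Function.ne_iff.mp hv
  obtain ⟨x, t, ht, hx, hxX⟩ := exists_point_of_ne_zero hv
  let U : (PSpace k n).Opens := Proj.basicOpen (grading k n) (MvPolynomial.X j)
  have hxU : x ∈ U := hxX j hj
  let s : Γ(twistHom k n (⋀[k]^(1 + 1) (V k n)) (0 - 1), U) :=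
    mkSec (fun y ↦ invX j y.1 • constMap γ y.1) fun w ↦
      IsTwistedSection.mul (l := -1) (l' := 0) rfl (IsTwistedSection.invX le_rfl)
        (isTwistedSection_constMap _ rfl U w)
  obtain ⟨U', i, hxU', σ, hσ⟩ := Scheme.Modules.locally_surjective_of_epi
    (contractOmega (show 2 + 1 = 3 from rfl) ω 0) U ((Omega.proj k n 1 0).app U s) x hxU
  obtain ⟨α, hα⟩ := Omega.exists_contractX_eq σ ⟨x, hxU'⟩
  have h1 := congrArg (fun τ ↦ Omega.fam τ ⟨x, hxU'⟩) hσ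
  dsimp only at h1
  rw [Omega.fam_contractOmega, Omega.fam_map, Omega.fam_proj, fam_mkSec, hα,
    ← contractX_comp_wedge ω (show 2 + 1 = 3 from rfl) (show 2 + (1 + 1) = 3 + 1 from rfl)] at h1
  have h2 := congrArg (IsLocalRing.residue (Loc x)) (LinearMap.congr_fun h1 (vec w))
  rw [residue_contractX hx, residue_contractX hx, LinearMap.comp_apply, h, map_zero, map_zero,
    mul_zero, LinearMap.smul_apply, constMap_apply, hγ, map_one, smul_eq_mul, mul_one] at h2
  exact mul_ne_zero ht
    ((IsLocalRing.residue_ne_zero_iff_isUnit _).mpr (isUnit_invX (hxX j hj))) h2.symm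

end Lefschetz

section

variable (ω : ⋀[k]^2 (V k n))

theorem contractX_sub {q : ℕ} {x : PSpace k n} (α β : ⋀[k]^(q + 1) (V k n) →ₗ[k] Loc x) :
    contractX q x (α - β) = contractX q x α - contractX q x β := by
  refine LinearMap.ext fun η ↦ ?_
  rw [LinearMap.sub_apply, contractX_apply, contractX_apply, contractX_apply,
    ← Finset.sum_sub_distrib]
  exact Finset.sum_congr rfl fun i _ ↦ by rw [LinearMap.sub_apply, mul_sub]

/-! ### The map `H⁰(φ(1))`. -/

section GlobalSections

/-- The global section of `Ω^q(q + 1)` given by a form on `⋀^{q+1} V`. -/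
def Omega.ofForm {q : ℕ} (α : ⋀[k]^(q + 1) (V k n) →ₗ[k] k) : Γ(Omega k n q 1, ⊤) :=
  (Omega.proj k n q 1).app ⊤
    (mkSec (fun x ↦ constMap α x.1) (isTwistedSection_constMap α (sub_self 1) ⊤))

theorem Omega.fam_ofForm {q : ℕ} (α : ⋀[k]^(q + 1) (V k n) →ₗ[k] k) (x : (⊤ : (PSpace k n).Opens)) :
    Omega.fam (Omega.ofForm α) x = contractX q x.1 (constMap α x.1) := by
  rw [Omega.ofForm, Omega.fam_proj, fam_mkSec]

theorem Omega.exists_eq_ofForm [CharZero k] (hn : 1 ≤ n) {p : ℕ}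
    (σ : Γ(Omega k n (p + 1) 1, ⊤)) : ∃ α, σ = Omega.ofForm α := by
  obtain ⟨α, hα⟩ := Omega.exists_fam_eq_contractX_constMap hn σ
  exact ⟨α, Omega.fam_ext fun x ↦ by rw [hα, Omega.fam_ofForm]⟩

theorem exists_point (k : Type u) [Field k] (n : ℕ) : Nonempty (PSpace k n) :=
  ⟨pointOfPrime ⊥ Ideal.isPrime_bot ⟨0, by simp⟩⟩

theorem Omega.ofForm_injective [CharZero k] {q : ℕ} :
    Function.Injective (Omega.ofForm (k := k) (n := n) (q := q)) := by
  intro α β h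
  obtain ⟨x⟩ := exists_point k n
  have h1 := congrArg (fun σ ↦ Omega.fam σ (⟨x, trivial⟩ : (⊤ : (PSpace k n).Opens))) h
  dsimp only at h1
  rw [Omega.fam_ofForm, Omega.fam_ofForm, ← sub_eq_zero, ← contractX_sub] at h1
  rw [← sub_eq_zero]
  refine eq_zero_of_contractX_constMap (x := x) (h1 ▸ congrArg _ ?_)
  refine LinearMap.ext fun w ↦ ?_
  simp only [constMap_apply, LinearMap.sub_apply, map_sub]

/-- This identifies `H⁰(φ(1))` with the transpose of `ω ∧ * : ⋀² V → ⋀⁴ V`. -/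
theorem contractOmega_ofForm (α : ⋀[k]^4 (V k n) →ₗ[k] k) :
    (contractOmega (show 2 + 1 = 3 from rfl) ω 1).app ⊤ (Omega.ofForm (q := 3) α) =
      Omega.ofForm (q := 1) (α ∘ₗ wedge (show 2 + 2 = 4 from rfl) ω) := by
  refine Omega.fam_ext fun x ↦ ?_
  rw [Omega.fam_contractOmega, Omega.fam_ofForm, Omega.fam_ofForm,
    ← contractX_comp_wedge ω (show 2 + 1 = 3 from rfl) (show 2 + (1 + 1) = 3 + 1 from rfl)]
  rfl

theorem bijective_contractOmega_of_bijective [CharZero k] (hn : 1 ≤ n)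
    (hω : Function.Bijective (wedge (show 2 + 2 = 4 from rfl) ω : ⋀[k]^2 (V k n) →ₗ[k] _)) :
    Function.Bijective ((contractOmega (show 2 + 1 = 3 from rfl) ω 1).app ⊤) := by
  let e := LinearEquiv.ofBijective _ hω
  constructor
  · intro σ τ h
    obtain ⟨α, rfl⟩ := Omega.exists_eq_ofForm hn σ
    obtain ⟨β, rfl⟩ := Omega.exists_eq_ofForm hn τ
    have h1 := (contractOmega_ofForm ω α).symm.trans (h.trans (contractOmega_ofForm ω β))
    have h2 := Omega.ofForm_injective h1
    congr 1
    refine LinearMap.ext fun ζ ↦ ?_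
    obtain ⟨η, rfl⟩ := hω.2 ζ
    exact LinearMap.congr_fun h2 η
  · intro τ
    obtain ⟨β, rfl⟩ := Omega.exists_eq_ofForm hn τ
    refine ⟨Omega.ofForm (q := 3) (β ∘ₗ e.symm.toLinearMap), ?_⟩
    rw [contractOmega_ofForm]
    congr 1
    refine LinearMap.ext fun η ↦ congrArg β ?_
    exact e.symm_apply_apply η

theorem eq_zero_of_surjective_contractOmega [CharZero k] (hn : 1 ≤ n)
    (hω : Function.Surjective ((contractOmega (show 2 + 1 = 3 from rfl) ω 1).app ⊤))
    {η : ⋀[k]^2 (V k n)} (h : wedge (show 2 + 2 = 4 from rfl) ω η = 0) : η = 0 := by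
  by_contra hη
  obtain ⟨γ, hγ⟩ := exists_dual_eq_one (k := k) hη
  obtain ⟨σ, hσ⟩ := hω (Omega.ofForm (q := 1) γ)
  obtain ⟨α, rfl⟩ := Omega.exists_eq_ofForm hn σ
  have h1 := LinearMap.congr_fun
    (Omega.ofForm_injective ((contractOmega_ofForm ω α).symm.trans hσ)) η
  rw [LinearMap.comp_apply, h, map_zero] at h1
  exact zero_ne_one (h1.trans hγ)

end GlobalSections

/-! ### Global generation of `Ker ψ(1)`. -/

section GloballyGenerated

variable {l : ℤ} {U U' : (PSpace k n).Opens}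

/-- The family of linear maps underlying a section of the kernel of
`contractStructure ω l : Ω²(2 + l) ⟶ 𝒪(l)`. -/
def kernelFam (κ : Γ(kernel (contractStructure ω l), U)) (x : U) : ⋀[k]^2 (V k n) →ₗ[k] Loc x.1 :=
  Omega.fam ((kernel.ι (contractStructure ω l)).app U κ) x

variable {ω}

theorem kernelFam_ext {κ κ' : Γ(kernel (contractStructure ω l), U)}
    (h : ∀ x, kernelFam ω κ x = kernelFam ω κ' x) : κ = κ' :=
  Scheme.Modules.app_injective_of_mono (kernel.ι (contractStructure ω l)) U (Omega.fam_ext h)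

theorem kernelFam_map (i : U' ⟶ U) (κ : Γ(kernel (contractStructure ω l), U)) (x : U') :
    kernelFam ω ((kernel (contractStructure ω l)).presheaf.map i.op κ) x =
      kernelFam ω κ ⟨x.1, i.le x.2⟩ := by
  rw [kernelFam, Scheme.Modules.naturality_apply, Omega.fam_map, kernelFam]

theorem kernelFam_zero (x : U) : kernelFam ω (0 : Γ(kernel (contractStructure ω l), U)) x = 0 := by
  rw [kernelFam, map_zero, Omega.fam, map_zero, fam_zero]

theorem kernelFam_add (κ κ' : Γ(kernel (contractStructure ω l), U)) (x : U) :
    kernelFam ω (κ + κ') x = kernelFam ω κ x + kernelFam ω κ' x := by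
  rw [kernelFam, map_add, Omega.fam, map_add, fam_add]
  rfl

theorem kernelFam_smul (r : Γ(PSpace k n, U)) (κ : Γ(kernel (contractStructure ω l), U)) (x : U) :
    kernelFam ω (r • κ) x = value r x • kernelFam ω κ x := by
  rw [kernelFam, Scheme.Modules.Hom.app_smul, Omega.fam, Scheme.Modules.Hom.app_smul, fam_smul]
  rfl

theorem kernelFam_sum {ι : Type*} (s : Finset ι) (κ : ι → Γ(kernel (contractStructure ω l), U))
    (x : U) : kernelFam ω (∑ i ∈ s, κ i) x = ∑ i ∈ s, kernelFam ω (κ i) x := by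
  classical
  induction s using Finset.induction_on with
  | empty => exact kernelFam_zero x
  | insert a s ha ih => rw [Finset.sum_insert ha, Finset.sum_insert ha, kernelFam_add, ih]

theorem kernelFam_apply_eq_zero (κ : Γ(kernel (contractStructure ω l), U)) (x : U) :
    kernelFam ω κ x ω = 0 :=
  (contractStructure_app_eq_zero ω).mp (Scheme.Modules.app_kernel_ι (contractStructure ω l) U κ) x

theorem exists_kernelFam_eq (σ : Γ(Omega k n 2 l, U)) (hσ : ∀ x, Omega.fam σ x ω = 0) :
    ∃ κ : Γ(kernel (contractStructure ω l), U), ∀ x, kernelFam ω κ x = Omega.fam σ x := by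
  obtain ⟨κ, hκ⟩ := Scheme.Modules.exists_app_kernel_ι_eq (contractStructure ω l) U σ
    ((contractStructure_app_eq_zero ω).mpr hσ)
  exact ⟨κ, fun x ↦ by rw [kernelFam, hκ]⟩

/-- The one-dimensional space `⋀⁰ V` is spanned by `1`. -/
theorem exists_smul_one_eq (η : ⋀[k]^0 (V k n)) :
    ∃ c : k, (η : ExteriorAlgebra k (V k n)) = c • 1 := by
  obtain ⟨x, hx⟩ := η
  rw [ExteriorAlgebra.exteriorPower, pow_zero] at hx
  obtain ⟨c, rfl⟩ := Submodule.mem_one.mp hx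
  exact ⟨c, Algebra.algebraMap_eq_smul_one c⟩

theorem comp_wedge_eq_zero_of_apply_eq_zero {W : Type*} [AddCommGroup W] [Module k W]
    {α : ⋀[k]^2 (V k n) →ₗ[k] W} (h : α ω = 0) :
    α ∘ₗ wedge (show 2 + 0 = 2 from rfl) ω = 0 := by
  refine LinearMap.ext fun η ↦ ?_
  obtain ⟨c, hc⟩ := exists_smul_one_eq η
  have : wedge (show 2 + 0 = 2 from rfl) ω η = c • ω :=
    Subtype.ext (by rw [coe_wedge, hc, mul_smul_comm, mul_one, Submodule.coe_smul])
  rw [LinearMap.comp_apply, this, map_smul, h, smul_zero, LinearMap.zero_apply]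

theorem contractX_sub_smul {q : ℕ} {x : PSpace k n} (α β : ⋀[k]^(q + 1) (V k n) →ₗ[k] Loc x)
    (c : Loc x) (η : ⋀[k]^q (V k n)) :
    contractX q x (α - c • β) η = contractX q x α η - c * contractX q x β η := by
  rw [contractX_sub, map_smul, LinearMap.sub_apply, LinearMap.smul_apply, smul_eq_mul]

/-- A local lift `α` of a section of the kernel matters only modulo Koszul boundaries. One of them
makes `α` vanish on `ω ∧ V`, and such forms are combinations, over the functions, of constant ones,
which are global sections of the kernel. -/
theorem isGloballyGenerated_of_injective [CharZero k]
    (h₁ : Function.Injective (wedge (show 2 + 1 = 3 from rfl) ω : ⋀[k]^1 (V k n) →ₗ[k] _))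
    (h₂ : Function.Injective (wedge (show 2 + 2 = 4 from rfl) ω : ⋀[k]^2 (V k n) →ₗ[k] _)) :
    IsGloballyGenerated (kernel (contractStructure ω 1)) := by
  obtain ⟨g₁, hg₁⟩ := LinearMap.exists_leftInverse_of_injective _ (LinearMap.ker_eq_bot.mpr h₁)
  obtain ⟨g₂, hg₂⟩ := LinearMap.exists_leftInverse_of_injective _ (LinearMap.ker_eq_bot.mpr h₂)
  let b := Module.finBasis k (⋀[k]^3 (V k n))
  -- A projector with kernel `ω ∧ V`: its coordinates span the forms that vanish on `ω ∧ V`.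
  let p : ⋀[k]^3 (V k n) →ₗ[k] ⋀[k]^3 (V k n) :=
    LinearMap.id - wedge (show 2 + 1 = 3 from rfl) ω ∘ₗ g₁
  have hp : p ∘ₗ wedge (show 2 + 1 = 3 from rfl) ω = 0 := by
    refine LinearMap.ext fun η ↦ ?_
    have h := LinearMap.congr_fun hg₁ η
    rw [LinearMap.comp_apply, LinearMap.id_apply] at h
    simp only [p, LinearMap.comp_apply, LinearMap.sub_apply, LinearMap.id_apply, h, sub_self,
      LinearMap.zero_apply]
  have hp' {x : PSpace k n} {α : ⋀[k]^3 (V k n) →ₗ[k] Loc x}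
      (hα : α ∘ₗ wedge (show 2 + 1 = 3 from rfl) ω = 0) :
      α = ∑ m, α (b m) • constMap (b.coord m ∘ₗ p) x := by
    refine LinearMap.ext fun ζ ↦ ?_
    have h1 : α ζ = α (p ζ) := by
      simp only [p, LinearMap.sub_apply, LinearMap.id_apply, map_sub]
      rw [LinearMap.comp_apply, ← LinearMap.comp_apply α, hα, LinearMap.zero_apply, sub_zero]
    rw [h1, LinearMap.sum_apply]
    conv_lhs => rw [← b.sum_repr (p ζ), map_sum]
    refine Finset.sum_congr rfl fun m _ ↦ ?_
    rw [map_smul, LinearMap.smul_apply, constMap_apply, Algebra.smul_def, smul_eq_mul,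
      mul_comm]
    rfl
  have hglob (m) : ∃ κ : Γ(kernel (contractStructure ω 1), ⊤),
      ∀ x, kernelFam ω κ x = contractX 2 x.1 (constMap (b.coord m ∘ₗ p) x.1) := by
    obtain ⟨κ, hκ⟩ := exists_kernelFam_eq (ω := ω) (Omega.ofForm (q := 2) (b.coord m ∘ₗ p))
      fun x ↦ by
        rw [Omega.fam_ofForm, contractX_apply]
        refine Finset.sum_eq_zero fun i _ ↦ ?_
        rw [basisVec_eq_vec, wedge_vec_comm _ rfl, constMap_apply, LinearMap.comp_apply]
        have := LinearMap.congr_fun hp (vec (Pi.single i 1))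
        rw [LinearMap.comp_apply] at this
        rw [this]
        simp
    exact ⟨κ, fun x ↦ by rw [hκ, Omega.fam_ofForm]⟩
  choose κ hκ using hglob
  refine Scheme.Modules.generatingSections_of_mem_globalSpan fun U θ x hx ↦ ?_
  obtain ⟨U₁, i₁, hx₁, s, hs⟩ :=
    Omega.exists_proj_eq ((kernel.ι (contractStructure ω 1)).app U θ) hx
  obtain ⟨j, hj⟩ := exists_X_notMem x
  let U₂ := U₁ ⊓ Proj.basicOpen (grading k n) (MvPolynomial.X j)
  let α (y : U₂) : ⋀[k]^3 (V k n) →ₗ[k] Loc y.1 := fam s ⟨y.1, y.2.1⟩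
  have hα (w) : IsTwistedSection (1 - 1) U₂ fun y ↦ α y w :=
    (isTwistedSection_fam s w).res inf_le_left
  have hαθ (y : U₂) : contractX 2 y.1 (α y) = kernelFam ω θ ⟨y.1, i₁.le y.2.1⟩ := by
    rw [← Omega.fam_proj s ⟨y.1, y.2.1⟩, hs, Omega.fam_map]
    rfl
  -- The obstruction `β` is a Koszul cycle because `θ` vanishes on `ω`. It is therefore the boundary
  -- of `δ`, and `g₂` turns `δ` into a form `ε` on `⋀⁴ V` with `ε ∘ (ω ∧ *) = δ`.
  let β (y : U₂) : ⋀[k]^1 (V k n) →ₗ[k] Loc y.1 := α y ∘ₗ wedge (show 2 + 1 = 3 from rfl) ω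
  have hβ (y : U₂) : contractX 0 y.1 (β y) = 0 := by
    refine (contractX_comp_wedge ω (show 2 + 0 = 2 from rfl)
      (show 2 + (0 + 1) = 2 + 1 from rfl) (α y)).trans ?_
    rw [hαθ]
    exact comp_wedge_eq_zero_of_apply_eq_zero (kernelFam_apply_eq_zero θ _)
  let δ (y : U₂) : ⋀[k]^2 (V k n) →ₗ[k] Loc y.1 :=
    invX j y.1 • (β y ∘ₗ contr (LinearMap.proj j) 1)
  have hδ (y : U₂) : contractX 1 y.1 (δ y) = β y := contractX_comp_contr (hβ y) y.2.2
  let ε (y : U₂) : ⋀[k]^4 (V k n) →ₗ[k] Loc y.1 := δ y ∘ₗ g₂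
  have hε (y : U₂) : contractX 3 y.1 (ε y) ∘ₗ wedge (show 2 + 1 = 3 from rfl) ω = β y := by
    refine (contractX_comp_wedge ω (show 2 + 1 = 3 from rfl)
      (show 2 + (1 + 1) = 3 + 1 from rfl) (ε y)).symm.trans ?_
    rw [← hδ, LinearMap.comp_assoc, hg₂, LinearMap.comp_id]
  let α' (y : U₂) : ⋀[k]^3 (V k n) →ₗ[k] Loc y.1 := α y - contractX 3 y.1 (ε y)
  have hα' (w) : IsTwistedSection 0 U₂ fun y ↦ α' y w := by
    refine (hα w).sub ?_
    simp only [contractX_apply]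
    refine IsTwistedSection.sum fun i ↦ IsTwistedSection.X_mul (l := -1) (l' := 1 - 1) rfl i ?_
    exact IsTwistedSection.mul (l := -1) (l' := 0) rfl (IsTwistedSection.invX inf_le_right)
      (hα _)
  have hα'ω (y : U₂) : α' y ∘ₗ wedge (show 2 + 1 = 3 from rfl) ω = 0 := by
    refine LinearMap.ext fun η ↦ ?_
    have h := LinearMap.congr_fun (hε y) η
    rw [LinearMap.comp_apply] at h
    simp only [α', LinearMap.comp_apply, LinearMap.sub_apply, h, β, sub_self, LinearMap.zero_apply]
  have hα'θ (y : U₂) : contractX 2 y.1 (α' y) = kernelFam ω θ ⟨y.1, i₁.le y.2.1⟩ := by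
    refine (contractX_sub (q := 2) _ _).trans ?_
    rw [contractX_contractX, hαθ]
    refine LinearMap.ext fun η ↦ ?_
    rw [LinearMap.sub_apply, LinearMap.zero_apply, sub_zero]
  -- The coefficients have degree `0`, so they are regular functions.
  choose r hr using fun m ↦ (hα' (b m)).exists_value_eq
  let i₂ : U₂ ⟶ U := homOfLE (inf_le_left.trans i₁.le)
  refine ⟨U₂, i₂, ⟨hx₁, hj⟩, ?_⟩
  have key : (kernel (contractStructure ω 1)).presheaf.map i₂.op θ =
      ∑ m, r m • (kernel (contractStructure ω 1)).presheaf.map (homOfLE le_top).op (κ m) := by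
    refine kernelFam_ext fun y ↦ ?_
    rw [kernelFam_map, kernelFam_sum, ← hα'θ, hp' (hα'ω y), map_sum]
    refine Finset.sum_congr rfl fun m _ ↦ ?_
    rw [kernelFam_smul, kernelFam_map, hκ, hr, map_smul]
  rw [key]
  exact sum_mem fun m _ ↦ Submodule.smul_mem _ _ (Submodule.subset_span ⟨κ m, rfl⟩)

/-- If `v ∧ η ∈ V ∧ ω` does not belong to the line spanned by `v ∧ ω`, then the global sections do
not generate the kernel at the point `[v]`. -/
theorem not_isGloballyGenerated [CharZero k] (hn : 1 ≤ n)
    (h₁ : Function.Injective (wedge (show 2 + 1 = 3 from rfl) ω : ⋀[k]^1 (V k n) →ₗ[k] _))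
    {v w : V k n} (hv : v ≠ 0) {η : ⋀[k]^2 (V k n)}
    (hη : wedge (Nat.add_comm 1 2) (vec v) η = wedge (show 2 + 1 = 3 from rfl) ω (vec w))
    {α₀ : ⋀[k]^3 (V k n) →ₗ[k] k} (hα₀ : α₀ (wedge (show 2 + 1 = 3 from rfl) ω (vec v)) = 0)
    (hα₀' : α₀ (wedge (show 2 + 1 = 3 from rfl) ω (vec w)) ≠ 0) :
    ¬ IsGloballyGenerated (kernel (contractStructure ω 1)) := by
  rintro ⟨G⟩
  obtain ⟨g, hg⟩ := LinearMap.exists_leftInverse_of_injective _ (LinearMap.ker_eq_bot.mpr h₁)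
  obtain ⟨j, hj⟩ := Function.ne_iff.mp hv
  obtain ⟨x, t, ht, hx, hxX⟩ := exists_point_of_ne_zero hv
  let U : (PSpace k n).Opens := Proj.basicOpen (grading k n) (MvPolynomial.X j)
  have hxU : x ∈ U := hxX j hj
  let f (y : PSpace k n) : Loc y := contractX 2 y (constMap α₀ y) ω
  have hf : IsTwistedSection 1 U fun y ↦ f y.1 := by
    simp only [f, contractX_apply]
    exact IsTwistedSection.sum fun i ↦ IsTwistedSection.X_mul (l := 0) rfl i
      (isTwistedSection_constMap _ rfl U _)
  -- The subtracted term makes the contraction vanish on `ω`. It does not change the value at `[v]`,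
  -- because `f` vanishes there by `hα₀`.
  let s : Γ(twistHom k n (⋀[k]^(2 + 1) (V k n)) (1 - 1), U) :=
    mkSec (fun y ↦ constMap α₀ y.1 -
      (invX j y.1 * f y.1) • constMap (LinearMap.proj j ∘ₗ toV ∘ₗ g) y.1) fun w ↦ by
        refine (isTwistedSection_constMap _ rfl U w).sub ?_
        refine IsTwistedSection.mul (l := 0) rfl ?_ (isTwistedSection_constMap _ rfl U w)
        exact IsTwistedSection.mul (l := -1) (l' := 1) rfl (IsTwistedSection.invX le_rfl) hf
  obtain ⟨κ, hκ⟩ := exists_kernelFam_eq (ω := ω) ((Omega.proj k n 2 1).app U s) fun y ↦ by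
    rw [Omega.fam_proj, fam_mkSec]
    refine (contractX_sub_smul (q := 2) _ _ _ _).trans ?_
    rw [sum_coord_mul_extension hg, mul_right_comm, mul_comm (invX _ _), X_mul_invX y.2, one_mul,
      sub_self]
  obtain ⟨U', i, hxU', h⟩ := Scheme.Modules.mem_globalSpan_of_generatingSections G U κ x hxU
  -- A global section comes from a constant `γ` that kills all `e_i ∧ ω`, hence also `v ∧ η = ω ∧
  -- w`.
  have key : ∀ θ ∈ Scheme.Modules.globalSpan (kernel (contractStructure ω 1)) U',
      IsLocalRing.residue (Loc x) (kernelFam ω θ ⟨x, hxU'⟩ η) = 0 := by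
    intro θ hθ
    induction hθ using Submodule.span_induction with
    | mem θ hθ =>
      obtain ⟨θ, rfl⟩ := hθ
      obtain ⟨γ, hγ⟩ := Omega.exists_fam_eq_contractX_constMap hn
        ((kernel.ι (contractStructure ω 1)).app ⊤ θ)
      have h0 := kernelFam_apply_eq_zero θ ⟨x, trivial⟩
      rw [kernelFam, hγ, contractX_apply] at h0
      have h1 := eq_zero_of_sum_coord_mul_eq_zero h0
      rw [kernelFam_map, kernelFam, hγ, residue_contractX hx, hη, ← wedge_vec_comm rfl,
        ← sum_smul_wedge_basisVec, map_sum]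
      have h2 (i) : constMap γ x (w i • wedge rfl (basisVec k n i) ω) = 0 := by
        rw [map_smul, constMap_apply]
        refine (congrArg (fun c ↦ w i • algebraMap k (Loc x) c) (congrFun h1 i)).trans ?_
        rw [Pi.zero_apply, map_zero, smul_zero]
      simp only [h2, Finset.sum_const_zero, map_zero, mul_zero]
    | zero => rw [kernelFam_zero, LinearMap.zero_apply, map_zero]
    | add θ θ' _ _ h h' => rw [kernelFam_add, LinearMap.add_apply, map_add, h, h', add_zero]
    | smul r θ _ h => rw [kernelFam_smul, LinearMap.smul_apply, smul_eq_mul, map_mul, h, mul_zero]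
  have h1 := key _ h
  have hfx : IsLocalRing.residue (Loc x) (f x) = 0 := by
    rw [residue_contractX hx, wedge_vec_comm _ rfl, constMap_apply, hα₀]
    simp
  rw [kernelFam_map, hκ, Omega.fam_proj, fam_mkSec, residue_contractX hx, hη, LinearMap.sub_apply,
    map_sub, LinearMap.smul_apply, smul_eq_mul, map_mul, map_mul, hfx, mul_zero, zero_mul, sub_zero,
    constMap_apply] at h1
  have hu : IsUnit (algebraMap k (Loc x) (α₀ (wedge (show 2 + 1 = 3 from rfl) ω (vec w)))) :=
    (IsUnit.mk0 _ hα₀').map _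
  exact mul_ne_zero ht ((IsLocalRing.residue_ne_zero_iff_isUnit _).mpr hu) h1

end GloballyGenerated

end

/-! ### Normal form of a bivector. -/

section NormalForm

theorem coe_ιMulti_two (v w : V k n) :
    (exteriorPower.ιMulti k 2 ![v, w] : ExteriorAlgebra k (V k n)) =
    ExteriorAlgebra.ι k v * ExteriorAlgebra.ι k w := by
  simp [ExteriorAlgebra.ιMulti_apply]

theorem ι_mul_swap (v w : V k n) : ExteriorAlgebra.ι k v * ExteriorAlgebra.ι k w =
    -(ExteriorAlgebra.ι k w * ExteriorAlgebra.ι k v) :=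
  eq_neg_of_add_eq_zero_left (ExteriorAlgebra.ι_add_mul_swap v w)

/-- `z` is a sum of `m` decomposable bivectors. -/
def IsSumOfBivectors (m : ℕ) (z : ExteriorAlgebra k (V k n)) : Prop :=
  ∃ a b : Fin m → V k n, z = ∑ i, ExteriorAlgebra.ι k (a i) * ExteriorAlgebra.ι k (b i)

theorem exists_isSumOfBivectors (ω : ⋀[k]^2 (V k n)) :
    ∃ m, IsSumOfBivectors m (ω : ExteriorAlgebra k (V k n)) := by
  suffices ∀ z ∈ LinearMap.range (ExteriorAlgebra.ι k (M := V k n)) *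
      LinearMap.range (ExteriorAlgebra.ι k (M := V k n)), ∃ m, IsSumOfBivectors m z from
    this ω (pow_two (LinearMap.range (ExteriorAlgebra.ι k (M := V k n))) ▸ ω.2)
  intro z hz
  refine Submodule.mul_induction_on hz ?_ ?_
  · rintro _ ⟨a, rfl⟩ _ ⟨b, rfl⟩
    exact ⟨1, fun _ ↦ a, fun _ ↦ b, by simp⟩
  · rintro _ _ ⟨m, a, b, rfl⟩ ⟨m', a', b', rfl⟩
    exact ⟨m + m', Fin.append a a', Fin.append b b', by simp [Fin.sum_univ_add]⟩

/-- Modulo `b_{i₀}`, the relation reads `a_{i₀} = ∑ C_i a_i + ∑ D_i b_i`; the product `a_{i₀} ∧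
b_{i₀}` is then absorbed by the others as `(a_i - D_i b_{i₀}) ∧ (b_i + C_i b_{i₀})`. -/
theorem IsSumOfBivectors.of_relation {m : ℕ} {a b : Fin (m + 1) → V k n} {c d : Fin (m + 1) → k}
    (h : ∑ i, c i • a i + ∑ i, d i • b i = 0) {i₀ : Fin (m + 1)} (hc : c i₀ ≠ 0) :
    IsSumOfBivectors m (∑ i, ExteriorAlgebra.ι k (a i) * ExteriorAlgebra.ι k (b i)) := by
  rw [Fin.sum_univ_succAbove _ i₀, Fin.sum_univ_succAbove _ i₀] at h
  have ha : a i₀ = ∑ i, (-(c i₀)⁻¹ * c (i₀.succAbove i)) • a (i₀.succAbove i) +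
      ∑ i, (-(c i₀)⁻¹ * d (i₀.succAbove i)) • b (i₀.succAbove i) +
        (-(c i₀)⁻¹ * d i₀) • b i₀ := by
    simp only [mul_smul, ← Finset.smul_sum]
    rw [← smul_add, ← smul_add, neg_smul, ← smul_neg, eq_inv_smul_iff₀ hc]
    rw [← sub_eq_zero, ← h]
    abel
  set C := fun i ↦ -(c i₀)⁻¹ * c (i₀.succAbove i)
  set D := fun i ↦ -(c i₀)⁻¹ * d (i₀.succAbove i)
  refine ⟨fun i ↦ a (i₀.succAbove i) - D i • b i₀, fun i ↦ b (i₀.succAbove i) + C i • b i₀, ?_⟩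
  have key (i : Fin m) : ExteriorAlgebra.ι k (a (i₀.succAbove i) - D i • b i₀) *
      ExteriorAlgebra.ι k (b (i₀.succAbove i) + C i • b i₀) =
        ExteriorAlgebra.ι k (a (i₀.succAbove i)) * ExteriorAlgebra.ι k (b (i₀.succAbove i)) +
        C i • (ExteriorAlgebra.ι k (a (i₀.succAbove i)) * ExteriorAlgebra.ι k (b i₀)) +
        D i • (ExteriorAlgebra.ι k (b (i₀.succAbove i)) * ExteriorAlgebra.ι k (b i₀)) := by
    rw [map_sub, map_add, sub_mul, mul_add, mul_add]
    simp only [map_smul, smul_mul_assoc, mul_smul_comm, ExteriorAlgebra.ι_sq_zero, smul_zero,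
      add_zero]
    rw [ι_mul_swap (b i₀), smul_neg, sub_neg_eq_add]
  simp only [key, Finset.sum_add_distrib]
  rw [Fin.sum_univ_succAbove _ i₀, ha]
  simp only [map_add, map_sum, map_smul, add_mul, Finset.sum_mul, smul_mul_assoc,
    ExteriorAlgebra.ι_sq_zero, smul_zero, add_zero]
  exact (add_comm _ _).trans (add_assoc _ _ _).symm

theorem IsSumOfBivectors.of_not_linearIndependent {m : ℕ} {a b : Fin (m + 1) → V k n}
    (h : ¬ LinearIndependent k (Sum.elim a b)) :
    IsSumOfBivectors m (∑ i, ExteriorAlgebra.ι k (a i) * ExteriorAlgebra.ι k (b i)) := by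
  rw [Fintype.not_linearIndependent_iff] at h
  obtain ⟨c, hc, i, hi⟩ := h
  rw [Fintype.sum_sum_type] at hc
  simp only [Sum.elim_inl, Sum.elim_inr] at hc
  rcases i with i | i
  · exact of_relation hc hi
  -- The roles are exchanged through `a ∧ b = b ∧ (-a)`.
  · have h1 : ∑ i, c (.inr i) • b i + ∑ i, (-c (.inl i)) • (-a i) = 0 := by
      simp only [neg_smul_neg]
      rw [add_comm]
      exact hc
    have h2 := of_relation h1 hi
    simpa only [map_neg, mul_neg, ← ι_mul_swap] using h2

/-- A sum with the least number of terms admits no linear relation. -/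
theorem exists_linearIndependent_sum (ω : ⋀[k]^2 (V k n)) :
    ∃ (m : ℕ) (a b : Fin m → V k n), LinearIndependent k (Sum.elim a b) ∧
      (ω : ExteriorAlgebra k (V k n)) =
        ∑ i, ExteriorAlgebra.ι k (a i) * ExteriorAlgebra.ι k (b i) := by
  classical
  have hm := Nat.find_spec (exists_isSumOfBivectors ω)
  have hmin := fun m ↦ Nat.find_min (exists_isSumOfBivectors ω) (m := m)
  generalize Nat.find (exists_isSumOfBivectors ω) = m at hm hmin
  obtain ⟨a, b, h⟩ := hm
  refine ⟨m, a, b, ?_, h⟩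
  cases m with
  | zero => exact linearIndependent_empty_type
  | succ m =>
    by_contra hab
    exact hmin m m.lt_succ_self (h ▸ IsSumOfBivectors.of_not_linearIndependent hab)

theorem exists_basis_extending {ι κ E : Type*} [Fintype κ] [AddCommGroup E] [Module k E]
    [Module.Finite k E] (hκ : Fintype.card κ = Module.finrank k E) {u : ι → E}
    (hu : LinearIndependent k u) (e : ι ↪ κ) :
    ∃ v : Module.Basis κ k E, ∀ i, v (e i) = u i := by
  classical
  let b := Module.Basis.extend hu.linearIndepOn_id
  have : Fintype (hu.linearIndepOn_id.extend (Set.subset_univ _)) :=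
    @Fintype.ofFinite _ (Module.Finite.finite_basis b)
  have hext (i : ι) : Function.extend e u 0 (e i) = u i := e.injective.extend_apply _ _ _
  obtain ⟨g, hg⟩ := Set.MapsTo.exists_equiv_extend_of_card_eq (s := Set.range e)
    (t := (hu.linearIndepOn_id.extend (Set.subset_univ _)).toFinset) (f := Function.extend e u 0)
    (by rw [Set.toFinset_card, hκ, Module.finrank_eq_card_basis b])
    (by
      rintro _ ⟨i, rfl⟩
      rw [hext, Set.coe_toFinset]
      exact hu.linearIndepOn_id.subset_extend _ ⟨i, rfl⟩)
    (by
      rintro _ ⟨i, rfl⟩ _ ⟨j, rfl⟩ h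
      rw [hext, hext] at h
      rw [hu.injective h])
  refine ⟨b.reindex ((g.trans (Equiv.subtypeEquivRight fun _ ↦ Set.mem_toFinset)).symm),
    fun i ↦ ?_⟩
  rw [Module.Basis.reindex_apply, Equiv.symm_symm, Module.Basis.extend_apply_self]
  exact (hg (e i) ⟨i, rfl⟩).trans (hext i)

theorem exists_normal_form (ω : ⋀[k]^2 (V k 5)) :
    (∃ (v : Module.Basis (Fin 6) k (V k 5)) (r : k), (ω : ExteriorAlgebra k (V k 5)) =
      r • (ExteriorAlgebra.ι k (v 0) * ExteriorAlgebra.ι k (v 1))) ∨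
      HasRankFour ω ∨ HasRankSix ω := by
  obtain ⟨m, a, b, hab, h⟩ := exists_linearIndependent_sum ω
  have hm : m ≤ 3 := by
    have := hab.fintype_card_le_finrank
    simp at this
    omega
  -- The vectors `a_i` and `b_i` take the places `2i` and `2i + 1` of the basis.
  let e : Fin m ⊕ Fin m ↪ Fin 6 :=
    ⟨Sum.elim (fun i ↦ ⟨2 * i, by omega⟩) (fun i ↦ ⟨2 * i + 1, by omega⟩), by
      rintro (i | i) (j | j) hij <;> simp only [Sum.elim_inl, Sum.elim_inr, Fin.mk.injEq] at hij <;>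
        first | (congr 1; ext; omega) | omega⟩
  obtain ⟨v, hv⟩ := exists_basis_extending (by simp) hab e
  have ha (i) : a i = v ⟨2 * i, by omega⟩ := (hv (.inl i)).symm
  have hb (i) : b i = v ⟨2 * i + 1, by omega⟩ := (hv (.inr i)).symm
  simp only [ha, hb] at h
  clear hv e hab ha hb
  interval_cases m
  · exact .inl ⟨v, 0, by simpa using h⟩
  · exact .inl ⟨v, 1, by simpa using h⟩
  · refine .inr (.inl ⟨v, Subtype.ext ?_⟩)
    rw [Submodule.coe_add, coe_ιMulti_two, coe_ιMulti_two, h, Fin.sum_univ_two]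
    rfl
  · refine .inr (.inr ⟨v, Subtype.ext ?_⟩)
    rw [Submodule.coe_add, Submodule.coe_add, coe_ιMulti_two, coe_ιMulti_two, coe_ιMulti_two, h,
      Fin.sum_univ_three]
    rfl

end NormalForm

/-! ### Exterior multiplication by `ω` in each rank. -/

section Lefschetz

theorem contractLeft_contractLeft_ι_mul_ι_mul {d e : Module.Dual k (V k n)} {a b : V k n}
    (hda : d a = 1) (hdb : d b = 0) (hea : e a = 0) (heb : e b = 1)
    (y : ExteriorAlgebra k (V k n)) :
    CliffordAlgebra.contractLeft (Q := (0 : QuadraticForm k (V k n))) e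
      (CliffordAlgebra.contractLeft (Q := (0 : QuadraticForm k (V k n))) d
        (ExteriorAlgebra.ι k a * ExteriorAlgebra.ι k b * y)) =
      y - ExteriorAlgebra.ι k a *
          CliffordAlgebra.contractLeft (Q := (0 : QuadraticForm k (V k n))) d y -
        ExteriorAlgebra.ι k b *
          CliffordAlgebra.contractLeft (Q := (0 : QuadraticForm k (V k n))) e y +
        ExteriorAlgebra.ι k a * ExteriorAlgebra.ι k b *
          CliffordAlgebra.contractLeft (Q := (0 : QuadraticForm k (V k n))) e
            (CliffordAlgebra.contractLeft (Q := (0 : QuadraticForm k (V k n))) d y) := by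
  rw [mul_assoc, contractLeft_ι_mul, contractLeft_ι_mul, hda, hdb, one_smul, zero_smul, zero_sub,
    mul_neg, sub_neg_eq_add, map_add, contractLeft_ι_mul, contractLeft_ι_mul, contractLeft_ι_mul,
    hea, heb, one_smul, one_smul, zero_smul, zero_sub, mul_sub, mul_assoc]
  abel

theorem contractLeft_contractLeft_ι_mul_ι_mul_of_eq_zero {d e : Module.Dual k (V k n)} {a b : V k n}
    (hda : d a = 0) (hdb : d b = 0) (hea : e a = 0) (heb : e b = 0)
    (y : ExteriorAlgebra k (V k n)) :
    CliffordAlgebra.contractLeft (Q := (0 : QuadraticForm k (V k n))) e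
      (CliffordAlgebra.contractLeft (Q := (0 : QuadraticForm k (V k n))) d
        (ExteriorAlgebra.ι k a * ExteriorAlgebra.ι k b * y)) =
        ExteriorAlgebra.ι k a * ExteriorAlgebra.ι k b *
          CliffordAlgebra.contractLeft (Q := (0 : QuadraticForm k (V k n))) e
            (CliffordAlgebra.contractLeft (Q := (0 : QuadraticForm k (V k n))) d y) := by
  rw [mul_assoc, contractLeft_ι_mul, contractLeft_ι_mul, hda, hdb, zero_smul, zero_smul, zero_sub,
    zero_sub, mul_neg, neg_neg, contractLeft_ι_mul, contractLeft_ι_mul,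
    hea, heb, zero_smul, zero_smul, zero_sub, zero_sub, mul_neg, neg_neg, mul_assoc]

theorem contractLeft_ι (d : Module.Dual k (V k n)) (v : V k n) :
    CliffordAlgebra.contractLeft (Q := (0 : QuadraticForm k (V k n))) d (ExteriorAlgebra.ι k v) =
      algebraMap k (ExteriorAlgebra k (V k n)) (d v) :=
  CliffordAlgebra.contractLeft_ι _ _ _

theorem contractLeft_contractLeft_ι (d e : Module.Dual k (V k n)) (v : V k n) :
    CliffordAlgebra.contractLeft (Q := (0 : QuadraticForm k (V k n))) e
      (CliffordAlgebra.contractLeft (Q := (0 : QuadraticForm k (V k n))) d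
        (ExteriorAlgebra.ι k v)) = 0 := by
  rw [contractLeft_ι]
  exact CliffordAlgebra.contractLeft_algebraMap _ _ _

/-- Contracting `a ∧ b ∧ w` with `d` and then `e` leaves `w - d(w) a - e(w) b`. -/
theorem eq_add_of_mul_ι_eq_zero {d e : Module.Dual k (V k n)} {a b w : V k n}
    {z : ExteriorAlgebra k (V k n)} (hda : d a = 1) (hdb : d b = 0) (hea : e a = 0) (heb : e b = 1)
    (hz : CliffordAlgebra.contractLeft (Q := (0 : QuadraticForm k (V k n))) e
      (CliffordAlgebra.contractLeft (Q := (0 : QuadraticForm k (V k n))) d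
        (z * ExteriorAlgebra.ι k w)) = 0)
    (h : (ExteriorAlgebra.ι k a * ExteriorAlgebra.ι k b + z) * ExteriorAlgebra.ι k w = 0) :
    w = d w • a + e w • b := by
  rw [add_mul] at h
  have h' := congrArg (fun y ↦ CliffordAlgebra.contractLeft (Q := (0 : QuadraticForm k (V k n))) e
    (CliffordAlgebra.contractLeft (Q := (0 : QuadraticForm k (V k n))) d y)) h
  simp only [map_add, hz, map_zero, add_zero] at h'
  rw [contractLeft_contractLeft_ι_mul_ι_mul hda hdb hea heb, contractLeft_contractLeft_ι, mul_zero,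
    add_zero, contractLeft_ι, contractLeft_ι, ← Algebra.commutes, ← Algebra.commutes,
    ← Algebra.smul_def, ← Algebra.smul_def, ← map_smul (ExteriorAlgebra.ι k),
    ← map_smul (ExteriorAlgebra.ι k), ← map_sub, ← map_sub, sub_sub] at h'
  exact sub_eq_zero.mp (ExteriorAlgebra.ι_eq_zero_iff _ |>.mp h')

variable {ω : ⋀[k]^2 (V k 5)} {v : Module.Basis (Fin 6) k (V k 5)}

theorem coord_apply_of_ne {i j : Fin 6} (h : j ≠ i) : v.coord i (v j) = 0 := by
  rw [Module.Basis.coord_apply, Module.Basis.repr_self, Finsupp.single_eq_of_ne' h]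

theorem coord_apply_self (i : Fin 6) : v.coord i (v i) = 1 := by
  rw [Module.Basis.coord_apply, Module.Basis.repr_self, Finsupp.single_eq_same]

/-- A vector killed by `ω` lies in the span of `v₀, v₁` and in that of `v₂, v₃`. The scalar `s`
covers rank four (`0`) and rank six (`1`). -/
theorem wedge_vec_injective {s : k} (hω : (ω : ExteriorAlgebra k (V k 5)) =
      ExteriorAlgebra.ι k (v 0) * ExteriorAlgebra.ι k (v 1) +
      ExteriorAlgebra.ι k (v 2) * ExteriorAlgebra.ι k (v 3) +
      s • (ExteriorAlgebra.ι k (v 4) * ExteriorAlgebra.ι k (v 5))) :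
    Function.Injective (wedge (show 2 + 1 = 3 from rfl) ω : ⋀[k]^1 (V k 5) →ₗ[k] _) := by
  rw [injective_iff_map_eq_zero]
  intro η hη
  obtain ⟨w, rfl⟩ := exists_eq_vec η
  have h0 : (ω : ExteriorAlgebra k (V k 5)) * ExteriorAlgebra.ι k w = 0 := by
    rw [← coe_vec]
    exact congrArg Subtype.val hη
  have h1 : w = v.coord 0 w • v 0 + v.coord 1 w • v 1 := by
    rw [hω, add_assoc] at h0
    refine eq_add_of_mul_ι_eq_zero (coord_apply_self _) (coord_apply_of_ne (by decide))
      (coord_apply_of_ne (by decide)) (coord_apply_self _) ?_ h0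
    rw [add_mul, smul_mul_assoc, map_add, map_add, map_smul, map_smul,
      contractLeft_contractLeft_ι_mul_ι_mul_of_eq_zero,
      contractLeft_contractLeft_ι_mul_ι_mul_of_eq_zero,
      contractLeft_contractLeft_ι, mul_zero, mul_zero, smul_zero, add_zero] <;>
    exact coord_apply_of_ne (by decide)
  have h2 : w = v.coord 2 w • v 2 + v.coord 3 w • v 3 := by
    rw [hω, add_comm (ExteriorAlgebra.ι k (v 0) * _), add_assoc] at h0
    refine eq_add_of_mul_ι_eq_zero (coord_apply_self _) (coord_apply_of_ne (by decide))
      (coord_apply_of_ne (by decide)) (coord_apply_self _) ?_ h0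
    rw [add_mul, smul_mul_assoc, map_add, map_add, map_smul, map_smul,
      contractLeft_contractLeft_ι_mul_ι_mul_of_eq_zero,
      contractLeft_contractLeft_ι_mul_ι_mul_of_eq_zero,
      contractLeft_contractLeft_ι, mul_zero, mul_zero, smul_zero, add_zero] <;>
    exact coord_apply_of_ne (by decide)
  have h3 {i : Fin 6} (h0 : 0 ≠ i) (h1' : 1 ≠ i) : v.coord i w = 0 := by
    rw [h1, map_add, map_smul, map_smul, coord_apply_of_ne h0, coord_apply_of_ne h1', smul_zero,
      smul_zero, add_zero]
  rw [vec_eq_zero, h2, h3 (by decide) (by decide), h3 (by decide) (by decide), zero_smul, zero_smul,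
    add_zero]

/-- Contraction with the bivector which is dual to `v₀ ∧ v₁ + v₂ ∧ v₃ + v₄ ∧ v₅`. -/
def lambda (v : Module.Basis (Fin 6) k (V k 5)) :
    ExteriorAlgebra k (V k 5) →ₗ[k] ExteriorAlgebra k (V k 5) :=
  CliffordAlgebra.contractLeft (Q := (0 : QuadraticForm k (V k 5))) (v.coord 1) ∘ₗ
      CliffordAlgebra.contractLeft (Q := (0 : QuadraticForm k (V k 5))) (v.coord 0) +
    CliffordAlgebra.contractLeft (Q := (0 : QuadraticForm k (V k 5))) (v.coord 3) ∘ₗ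
      CliffordAlgebra.contractLeft (Q := (0 : QuadraticForm k (V k 5))) (v.coord 2) +
    CliffordAlgebra.contractLeft (Q := (0 : QuadraticForm k (V k 5))) (v.coord 5) ∘ₗ
      CliffordAlgebra.contractLeft (Q := (0 : QuadraticForm k (V k 5))) (v.coord 4)

theorem lambda_mem (v : Module.Basis (Fin 6) k (V k 5)) {q : ℕ} {x : ExteriorAlgebra k (V k 5)}
    (hx : x ∈ ⋀[k]^(q + 2) (V k 5)) : lambda v x ∈ ⋀[k]^q (V k 5) :=
  add_mem (add_mem (contractLeft_mem _ _ _ (contractLeft_mem _ _ _ hx))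
    (contractLeft_mem _ _ _ (contractLeft_mem _ _ _ hx)))
    (contractLeft_mem _ _ _ (contractLeft_mem _ _ _ hx))

/-- The `sl₂` commutation relation. Distinct pairs commute; each of the three matching pairs
contributes `x` minus its two terms of Euler's sum, and these terms total `q • x`. -/
theorem lambda_mul (hω : (ω : ExteriorAlgebra k (V k 5)) =
      ExteriorAlgebra.ι k (v 0) * ExteriorAlgebra.ι k (v 1) +
      ExteriorAlgebra.ι k (v 2) * ExteriorAlgebra.ι k (v 3) +
      ExteriorAlgebra.ι k (v 4) * ExteriorAlgebra.ι k (v 5)) {q : ℕ}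
    {x : ExteriorAlgebra k (V k 5)} (hx : x ∈ ⋀[k]^q (V k 5)) :
    lambda v (ω * x) = (3 - q : k) • x + ω * lambda v x := by
  have h := sum_ι_mul_contractLeft v q x hx
  rw [Fin.sum_univ_six] at h
  rw [sub_smul, ← h, hω, ofNat_smul_eq_nsmul]
  simp only [lambda, LinearMap.add_apply, LinearMap.comp_apply, add_mul, mul_add, map_add]
  simp only [contractLeft_contractLeft_ι_mul_ι_mul (coord_apply_self _)
      (coord_apply_of_ne (show (1 : Fin 6) ≠ 0 by decide))
        (coord_apply_of_ne (show (0 : Fin 6) ≠ 1 by decide)) (coord_apply_self _),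
    contractLeft_contractLeft_ι_mul_ι_mul (coord_apply_self _)
      (coord_apply_of_ne (show (3 : Fin 6) ≠ 2 by decide))
        (coord_apply_of_ne (show (2 : Fin 6) ≠ 3 by decide)) (coord_apply_self _),
    contractLeft_contractLeft_ι_mul_ι_mul (coord_apply_self _)
      (coord_apply_of_ne (show (5 : Fin 6) ≠ 4 by decide))
        (coord_apply_of_ne (show (4 : Fin 6) ≠ 5 by decide)) (coord_apply_self _),
    contractLeft_contractLeft_ι_mul_ι_mul_of_eq_zero
      (coord_apply_of_ne (show (0 : Fin 6) ≠ 2 by decide))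
      (coord_apply_of_ne (show (1 : Fin 6) ≠ 2 by decide))
      (coord_apply_of_ne (show (0 : Fin 6) ≠ 3 by decide))
      (coord_apply_of_ne (show (1 : Fin 6) ≠ 3 by decide)),
    contractLeft_contractLeft_ι_mul_ι_mul_of_eq_zero
      (coord_apply_of_ne (show (0 : Fin 6) ≠ 4 by decide))
      (coord_apply_of_ne (show (1 : Fin 6) ≠ 4 by decide))
      (coord_apply_of_ne (show (0 : Fin 6) ≠ 5 by decide))
      (coord_apply_of_ne (show (1 : Fin 6) ≠ 5 by decide)),
    contractLeft_contractLeft_ι_mul_ι_mul_of_eq_zero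
      (coord_apply_of_ne (show (2 : Fin 6) ≠ 0 by decide))
      (coord_apply_of_ne (show (3 : Fin 6) ≠ 0 by decide))
      (coord_apply_of_ne (show (2 : Fin 6) ≠ 1 by decide))
      (coord_apply_of_ne (show (3 : Fin 6) ≠ 1 by decide)),
    contractLeft_contractLeft_ι_mul_ι_mul_of_eq_zero
      (coord_apply_of_ne (show (2 : Fin 6) ≠ 4 by decide))
      (coord_apply_of_ne (show (3 : Fin 6) ≠ 4 by decide))
      (coord_apply_of_ne (show (2 : Fin 6) ≠ 5 by decide))
      (coord_apply_of_ne (show (3 : Fin 6) ≠ 5 by decide)),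
    contractLeft_contractLeft_ι_mul_ι_mul_of_eq_zero
      (coord_apply_of_ne (show (4 : Fin 6) ≠ 0 by decide))
      (coord_apply_of_ne (show (5 : Fin 6) ≠ 0 by decide))
      (coord_apply_of_ne (show (4 : Fin 6) ≠ 1 by decide))
      (coord_apply_of_ne (show (5 : Fin 6) ≠ 1 by decide)),
    contractLeft_contractLeft_ι_mul_ι_mul_of_eq_zero
      (coord_apply_of_ne (show (4 : Fin 6) ≠ 2 by decide))
      (coord_apply_of_ne (show (5 : Fin 6) ≠ 2 by decide))
      (coord_apply_of_ne (show (4 : Fin 6) ≠ 3 by decide))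
      (coord_apply_of_ne (show (5 : Fin 6) ≠ 3 by decide))]
  abel

theorem HasRankFour.exists_coe_eq (h : HasRankFour ω) :
    ∃ v : Module.Basis (Fin 6) k (V k 5), (ω : ExteriorAlgebra k (V k 5)) =
      ExteriorAlgebra.ι k (v 0) * ExteriorAlgebra.ι k (v 1) +
      ExteriorAlgebra.ι k (v 2) * ExteriorAlgebra.ι k (v 3) := by
  obtain ⟨v, rfl⟩ := h
  exact ⟨v, by rw [Submodule.coe_add, coe_ιMulti_two, coe_ιMulti_two]⟩

theorem HasRankSix.exists_coe_eq (h : HasRankSix ω) :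
    ∃ v : Module.Basis (Fin 6) k (V k 5), (ω : ExteriorAlgebra k (V k 5)) =
      ExteriorAlgebra.ι k (v 0) * ExteriorAlgebra.ι k (v 1) +
      ExteriorAlgebra.ι k (v 2) * ExteriorAlgebra.ι k (v 3) +
      ExteriorAlgebra.ι k (v 4) * ExteriorAlgebra.ι k (v 5) := by
  obtain ⟨v, rfl⟩ := h
  exact ⟨v, by rw [Submodule.coe_add, Submodule.coe_add, coe_ιMulti_two, coe_ιMulti_two,
    coe_ιMulti_two]⟩

theorem HasRankFour.injective_wedge (h : HasRankFour ω) :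
    Function.Injective (wedge (show 2 + 1 = 3 from rfl) ω : ⋀[k]^1 (V k 5) →ₗ[k] _) := by
  obtain ⟨v, hv⟩ := h.exists_coe_eq
  exact wedge_vec_injective (v := v) (s := 0) (by rw [hv, zero_smul, add_zero])

theorem HasRankSix.injective_wedge (h : HasRankSix ω) :
    Function.Injective (wedge (show 2 + 1 = 3 from rfl) ω : ⋀[k]^1 (V k 5) →ₗ[k] _) := by
  obtain ⟨v, hv⟩ := h.exists_coe_eq
  exact wedge_vec_injective (v := v) (s := 1) (by rw [hv, one_smul])

/-- If `ω ∧ η = 0`, then `lambda_mul` gives `η = -c ω` with `c = lambda v η`; as `lambda v ω = 3`,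
this forces `c = -3c`, so `c = 0`. Both spaces have dimension 15. -/
theorem HasRankSix.bijective_wedge [CharZero k] (h : HasRankSix ω) :
    Function.Bijective (wedge (show 2 + 2 = 4 from rfl) ω : ⋀[k]^2 (V k 5) →ₗ[k] _) := by
  obtain ⟨v, hv⟩ := h.exists_coe_eq
  have hinj : Function.Injective (wedge (show 2 + 2 = 4 from rfl) ω : ⋀[k]^2 (V k 5) →ₗ[k] _) := by
    rw [injective_iff_map_eq_zero]
    intro η hη
    have h0 : (ω : ExteriorAlgebra k (V k 5)) * η = 0 := congrArg Subtype.val hη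
    obtain ⟨c, hc⟩ := exists_smul_one_eq ⟨lambda v η, lambda_mem v η.2⟩
    have hc : lambda v (η : ExteriorAlgebra k (V k 5)) = c • 1 := hc
    have h1 := lambda_mul hv η.2
    rw [h0, map_zero, hc, mul_smul_comm, mul_one, show (3 : k) - (2 : ℕ) = 1 by norm_num, one_smul]
      at h1
    have h2 : lambda v (ω : ExteriorAlgebra k (V k 5)) = (3 : k) • 1 := by
      have h := lambda_mul hv (q := 0) (x := 1)
        (by rw [ExteriorAlgebra.exteriorPower, pow_zero]
            exact Submodule.mem_one.mpr ⟨1, map_one _⟩)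
      have h' : lambda v (1 : ExteriorAlgebra k (V k 5)) = 0 := by
        have h (i : Fin 6) : CliffordAlgebra.contractLeft (Q := (0 : QuadraticForm k (V k 5)))
            (v.coord i) (1 : ExteriorAlgebra k (V k 5)) = 0 := CliffordAlgebra.contractLeft_one _ _
        simp only [lambda, LinearMap.add_apply, LinearMap.comp_apply, h, map_zero, add_zero]
      rwa [h', mul_zero, mul_one, add_zero, Nat.cast_zero, sub_zero] at h
    have h3 : (η : ExteriorAlgebra k (V k 5)) = -c • (ω : ExteriorAlgebra k (V k 5)) := by
      rw [neg_smul]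
      exact eq_neg_of_add_eq_zero_left h1.symm
    have h4 : (c + c * 3) • (1 : ExteriorAlgebra k (V k 5)) = 0 := by
      have h := hc
      rw [h3, map_smul, h2, smul_smul] at h
      rw [add_smul, ← h, ← add_smul, neg_mul, neg_add_cancel, zero_smul]
    rw [← Algebra.algebraMap_eq_smul_one, ExteriorAlgebra.algebraMap_eq_zero_iff] at h4
    have h5 : c = 0 := by linear_combination h4 / 4
    refine Subtype.ext ?_
    rw [h3, h5, neg_zero, zero_smul]
    rfl
  refine ⟨hinj, (LinearMap.injective_iff_surjective_of_finrank_eq_finrank ?_).mp hinj⟩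
  rw [exteriorPower.finrank_eq, exteriorPower.finrank_eq, Module.finrank_fin_fun]
  rfl

theorem ι_mul_ι_mul_ι_self (v w : V k n) :
    ExteriorAlgebra.ι k v * ExteriorAlgebra.ι k w * ExteriorAlgebra.ι k v = 0 := by
  rw [ι_mul_swap v w, neg_mul, mul_assoc, ExteriorAlgebra.ι_sq_zero, mul_zero, neg_zero]

theorem ι_mul_ι_ne_zero {i j : Fin 6} (h : i ≠ j) :
    ExteriorAlgebra.ι k (v i) * ExteriorAlgebra.ι k (v j) ≠ 0 := by
  intro h0
  have h1 := congrArg (CliffordAlgebra.contractLeft (Q := (0 : QuadraticForm k (V k 5)))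
    (v.coord i)) h0
  rw [contractLeft_ι_mul, contractLeft_ι, coord_apply_self, coord_apply_of_ne h.symm, one_smul,
    map_zero, mul_zero, sub_zero, map_zero, ExteriorAlgebra.ι_eq_zero_iff] at h1
  exact v.ne_zero j h1

/-- When `ω` involves only `v₀ ∧ v₁` and `v₂ ∧ v₃`, the product `v₀ ∧ v₂` shares a factor with each
term. -/
theorem exists_wedge_wedge_vec_eq_zero (h : ¬ HasRankSix ω) :
    ∃ v w : V k 5, wedge (Nat.add_comm 1 1) (vec v) (vec w) ≠ 0 ∧
      wedge (show 2 + 2 = 4 from rfl) ω (wedge (Nat.add_comm 1 1) (vec v) (vec w)) = 0 := by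
  have : ∃ (v : Module.Basis (Fin 6) k (V k 5)) (r s : k), (ω : ExteriorAlgebra k (V k 5)) =
      r • (ExteriorAlgebra.ι k (v 0) * ExteriorAlgebra.ι k (v 1)) +
      s • (ExteriorAlgebra.ι k (v 2) * ExteriorAlgebra.ι k (v 3)) := by
    obtain ⟨v, r, h⟩ | h | h' := exists_normal_form ω
    · exact ⟨v, r, 0, by rw [h, zero_smul, add_zero]⟩
    · obtain ⟨v, h⟩ := h.exists_coe_eq
      exact ⟨v, 1, 1, by rw [h, one_smul, one_smul]⟩
    · exact absurd h' h
  obtain ⟨v, r, s, hω⟩ := this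
  have hvw : ((wedge (Nat.add_comm 1 1) (vec (v 0)) (vec (v 2)) : ⋀[k]^2 (V k 5)) :
      ExteriorAlgebra k (V k 5)) = ExteriorAlgebra.ι k (v 0) * ExteriorAlgebra.ι k (v 2) := by
    rw [coe_wedge, coe_vec, coe_vec]
  refine ⟨v 0, v 2, fun h ↦ ι_mul_ι_ne_zero (v := v) (show (0 : Fin 6) ≠ 2 by decide) ?_,
    Subtype.ext ?_⟩
  · rw [← hvw, h]
    rfl
  · rw [coe_wedge, hvw, hω, add_mul, smul_mul_assoc, smul_mul_assoc, ← mul_assoc,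
      ι_mul_ι_mul_ι_self, zero_mul, smul_zero, zero_add, ι_mul_swap (v 0) (v 2), mul_neg,
      ← mul_assoc, ι_mul_ι_mul_ι_self, zero_mul, neg_zero, smul_zero]
    rfl

theorem hasRankFour_or_hasRankSix_of_injective
    (h : Function.Injective (wedge (show 2 + 1 = 3 from rfl) ω : ⋀[k]^1 (V k 5) →ₗ[k] _)) :
    HasRankFour ω ∨ HasRankSix ω := by
  obtain ⟨v, r, hω⟩ | h' := exists_normal_form ω
  · have h0 : vec (v 0) = 0 := by
      refine (injective_iff_map_eq_zero _).mp h _ (Subtype.ext ?_)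
      rw [coe_wedge, coe_vec, hω, smul_mul_assoc, ι_mul_ι_mul_ι_self, smul_zero]
      rfl
    exact absurd (vec_eq_zero.mp h0) (v.ne_zero 0)
  · exact h'

theorem HasRankFour.not_isGloballyGenerated [CharZero k] (h : HasRankFour ω) :
    ¬ IsGloballyGenerated (kernel (contractStructure ω 1)) := by
  obtain ⟨v, hω⟩ := h.exists_coe_eq
  obtain ⟨g, hg⟩ := LinearMap.exists_leftInverse_of_injective _
    (LinearMap.ker_eq_bot.mpr h.injective_wedge)
  have hα (i : Fin 6) : (v.coord 2 ∘ₗ toV ∘ₗ g) (wedge (show 2 + 1 = 3 from rfl) ω (vec (v i))) =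
      v.coord 2 (v i) := by
    have h := LinearMap.congr_fun hg (vec (v i))
    rw [LinearMap.comp_apply, LinearMap.id_apply] at h
    rw [LinearMap.comp_apply, LinearMap.comp_apply, h, toV_vec]
  -- The point is `[v₀]`, where `v₀ ∧ (v₁ ∧ v₂) = ω ∧ v₂` because `v₂ ∧ v₃ ∧ v₂ = 0`; the form `α₀`
  -- reads off the coordinate of `v₂` along `ω ∧ V`.
  refine ProjContraction.not_isGloballyGenerated (by norm_num) h.injective_wedge (v.ne_zero 0)
    (w := v 2) (η := wedge (Nat.add_comm 1 1) (vec (v 1)) (vec (v 2)))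
    (α₀ := v.coord 2 ∘ₗ toV ∘ₗ g) (Subtype.ext ?_) ?_ ?_
  · simp only [coe_wedge, coe_vec]
    rw [hω, add_mul, ι_mul_ι_mul_ι_self, add_zero, mul_assoc]
  · rw [hα, coord_apply_of_ne (by decide)]
  · rw [hα, coord_apply_self]
    exact one_ne_zero

end Lefschetz

end ProjContraction

end

theorem lemmaL {k : Type u} [Field k] [IsAlgClosed k] [CharZero k]
    (ω : ⋀[k]^2 (ProjContraction.V k 5)) :
    List.TFAE [
      CategoryTheory.Epi (ProjContraction.contractOmega (show 2 + 1 = 3 from rfl) ω 0),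
      ProjContraction.HasRankSix ω,
      Function.Bijective
        ((ProjContraction.contractOmega (show 2 + 1 = 3 from rfl) ω 1).app ⊤)] ∧
    (CategoryTheory.Epi (ProjContraction.contractStructure ω 0) ↔
      ProjContraction.HasRankFour ω ∨ ProjContraction.HasRankSix ω) ∧
    (CategoryTheory.Epi (ProjContraction.contractStructure ω 0) →
      (ProjContraction.IsGloballyGenerated
          (CategoryTheory.Limits.kernel (ProjContraction.contractStructure ω 1)) ↔
        ProjContraction.HasRankSix ω)) := by
  have hψ : CategoryTheory.Epi (ProjContraction.contractStructure ω 0) ↔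
      ProjContraction.HasRankFour ω ∨ ProjContraction.HasRankSix ω := by
    rw [ProjContraction.epi_contractStructure_iff]
    exact ⟨ProjContraction.hasRankFour_or_hasRankSix_of_injective,
      fun h ↦ h.elim (·.injective_wedge) (·.injective_wedge)⟩
  refine ⟨?_, hψ, fun h ↦ ⟨fun hgg ↦ ?_, fun h6 ↦ ?_⟩⟩
  · tfae_have 2 → 1 := fun h ↦
      ProjContraction.epi_contractOmega_of_injective ω h.bijective_wedge.1
    tfae_have 1 → 2 := fun h ↦ by
      by_contra h6
      obtain ⟨v, w, h0, h1⟩ := ProjContraction.exists_wedge_wedge_vec_eq_zero h6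
      exact h0 (ProjContraction.wedge_vec_eq_zero_of_epi ω h1)
    tfae_have 2 → 3 := fun h ↦
      ProjContraction.bijective_contractOmega_of_bijective ω (by norm_num) h.bijective_wedge
    tfae_have 3 → 2 := fun h ↦ by
      by_contra h6
      obtain ⟨v, w, h0, h1⟩ := ProjContraction.exists_wedge_wedge_vec_eq_zero h6
      exact h0 (ProjContraction.eq_zero_of_surjective_contractOmega ω (by norm_num) h.2 h1)
    tfae_finish
  · exact (hψ.mp h).resolve_left fun h4 ↦ h4.not_isGloballyGenerated hgg
  · exact ProjContraction.isGloballyGenerated_of_injective h6.injective_wedge h6.bijective_wedge.1
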